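/- **Setting.** Let $n\ge 2$ and let $\Omega\subset\mathbb R^n$ be a bounded connected open set with Lipschitz boundary and outer unit normal $\nu$. Let $\partial_D\Omega\neq\emptyset$ and $\partial_N\Omega$ be disjoint, relatively open subsets of $\partial\Omega$ with the same relative boundary $\Gamma$, with $\partial\Omega=\partial_D\Omega\cup\partial_N\Omega\cup\Gamma$ and $\mathcal H^{n-2}(\Gamma)<\infty$ (the case $\partial_N\Omega=\emptyset$, $\partial_D\Omega=\partial\Omega$ is included). Let $M$ be the space of symmetric $n\times n$ matrices with $\xi:\eta=\sum_{ij}\xi_{ij}\eta_{ij}$, and write $\mathrm Eu$ for the symmetrized gradient. *Constitutive data.* (i) $\mathbb C:M\to M$ is linear and symmetric, $\gamma_1|\xi|^2\le\mathbb C\xi:\xi\le\gamma_2|\xi|^2$ with $\gamma_1,\gamma_2>0$. (ii) $\mathbb C_1\in C([0,1);\mathrm{Lin}(M;M))$ has symmetric values, $\mathbb C_1(a)=0$ iff $a=0$, $a\mapsto\mathbb C_1(a)\xi:\xi$ is nondecreasing, $\mathbb C_1(a)\xi:\xi\ge\gamma(a)|\xi|^2$ with $\gamma:[0,1]\to[0,\infty)$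 nondecreasing and vanishing only at $0$, and $\mathbb C_1(a)\xi:\xi\to+\infty$ as $a\to1^-$, uniformly for $|\xi|=1$ (formally $\mathbb C_1(1)=+\infty$). (iii) $K\subset M$ is closed and convex and contains a ball of positive radius centred at $0$; $H(\xi)=\sup_{\sigma\in K}\sigma:\xi\in[0,\infty]$. (iv) $D:L^1(\Omega)\to[0,\infty)$ is continuous. *Loads.* $T>0$, $w\in AC([0,T];H^1(\mathbb R^n;\mathbb R^n))$, $f\in AC([0,T];L^n(\mathbb R^n;\mathbb R^n))$, $g\in AC([0,T];L^\infty(\partial_N\Omega;\mathbb R^n))$, and $\langle\mathcal L(t),v\rangle=\int_\Omega f(t)\cdot v\,dx+\int_{\partial_N\Omega}g(t)\cdot v\,d\mathcal H^{n-1}$ for $v\in BD(\Omega)$. Safe load condition: there are $\varrho\in AC([0,T];L^n(\Omega;M))$ and $\tau_0>0$ such that for every $t$: $-\mathrm{div}\,\varrho(t)=f(t)$ in $\Omega$, $\varrho(t)+\tau\in K$ a.e. in $\Omega$ for all $|\tau|\le\tau_0$, and, if $\partial_N\Omega\ne\emptyset$, also $[\varrho(t)\nu]=g(t)$ on $\partial_N\Omega$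 and $|\varrho(t):p|\le C_\varrho|p|$ as measures, with $C_\varrho$ independent of $t$, for all plastic strains $p$ of admissible triples (the product $\varrho(t):p$ being defined by integration by parts). *Admissible triples.* For $w\in H^1(\mathbb R^n;\mathbb R^n)$, $A(w)$ is the set of $(u,e,p)\in BD(\Omega)\times L^2(\Omega;M)\times M_b(\Omega\cup\partial_D\Omega;M)$ such that $\mathrm Eu=e+p$ in $\Omega$ and $p=(w-u)\odot\nu\,\mathcal H^{n-1}$ on $\partial_D\Omega$. *Energies.* $\mathcal Q(e)=\frac12\int_\Omega\mathbb Ce:e\,dx$ and $\mathcal H(p)=\int_{\Omega\cup\partial_D\Omega}H\big(\frac{dp}{d|p|}\big)d|p|$. Let $p^a$ (identified with its Lebesgue density) and $p^s$ be the absolutely continuous and singular parts of $p$, and let $\tilde\alpha$ be the $\mathrm{Cap}_2$-quasicontinuous representative of $\alpha\in H^1(\Omega;[0,1])$ in $\Omega$ and its trace on $\partial_D\Omega$. Then $\tilde Q(\alpha,p)=\int_{\Omega\setminus\{\alpha=1\}}\mathbb C_1(\alpha)p^a:p^a\,dx$ if $|p^s|(\{\tilde\alpha>0\})=0$ and $p=0$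 on $\{\alpha=1\}$, and $\tilde Q(\alpha,p)=+\infty$ otherwise. Put $\mathcal E_t(\alpha,u,e,p)=\mathcal Q(e)+D(\alpha)+\|\nabla\alpha\|_{L^2}^2+\tilde Q(\alpha,p)-\langle\mathcal L(t),u\rangle$. A state $(\alpha,u,e,p)$ is *stable at time $t$* if $(u,e,p)\in A(w(t))$ and $\mathcal E_t(\alpha,u,e,p)\le\mathcal E_t(\beta,v,\eta,q)+\mathcal H(q-p)$ for all $\beta\in H^1(\Omega)$ with $0\le\beta\le\alpha$ and all $(v,\eta,q)\in A(w(t))$. *Evolutions.* Let $(\alpha_0,u_0,e_0,p_0)$, with $0\le\alpha_0\le1$, be stable at time $0$. An energetic evolution is a map $t\in[0,T]\mapsto(\alpha(t),u(t),e(t),p(t))$, $\alpha(t)\in H^1(\Omega;[0,1])$, such that: (qs0) $\alpha(t)\le\alpha(s)$ a.e. in $\Omega$ for $0\le s\le t\le T$; (qs1) the state at time $t$ is stable at time $t$, for every $t$; (qs2) $p$ has bounded variation on $[0,T]$ and, for every $t$, $$\mathcal E_t(\alpha(t),u(t),e(t),p(t))+\mathcal V_{\mathcal H}(p;0,t)=\mathcal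 E_0(\alpha_0,u_0,e_0,p_0)+\int_0^t\langle\mathbb Ce(s),\mathrm E\dot w(s)\rangle ds-\int_0^t\{\langle\dot{\mathcal L}(s),u(s)\rangle+\langle\mathcal L(s),\dot w(s)\rangle\}ds,$$ where $\mathcal V_{\mathcal H}(p;0,t)$ is the supremum of $\sum_j\mathcal H(p(t_j)-p(t_{j-1}))$ over the partitions of $[0,t]$. **Proposition.** For every such evolution and every $t\in[0,T]$, with $\sigma(t):=\mathbb Ce(t)$: 1. $-\mathrm{div}\,\sigma(t)=f(t)$ in the sense of distributions in $\Omega$; 2. $[\sigma(t)\nu]=g(t)$ on $\partial_N\Omega$, that is, $\int_\Omega\mathrm{div}\,\sigma(t)\cdot\psi\,dx+\int_\Omega\sigma(t):\mathrm E\psi\,dx=\int_{\partial_N\Omega}g(t)\cdot\psi\,d\mathcal H^{n-1}$ for every $\psi\in H^1(\Omega;\mathbb R^n)$ with zero trace on $\partial_D\Omega$; 3. $\sigma(t)-2\,\mathbb C_1(\alpha(t))\,p^a(t)\in K$ a.e. in $\{x\in\Omega:\alpha(t)(x)<1\}$, i.e. wherever $\mathbb C_1(\alpha(t))$ is defined.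 -/

import Mathlib

open MeasureTheory Set Filter Topology
open scoped ENNReal NNReal ContDiff RealInnerProductSpace

noncomputable section

namespace GeoPlast

/-! ### Linear algebra and test functions -/

/-- `ℝⁿ` with the Euclidean norm. -/
abbrev Vec (n : ℕ) := EuclideanSpace ℝ (Fin n)

/-- The symmetric `n × n` matrices inside `ℝ^{n × n}`. The inner product is
`ξ : η = ∑ i j, ξ i j * η i j` and the norm is the Euclidean norm. -/
def symSubmodule (n : ℕ) : Submodule ℝ (EuclideanSpace ℝ (Fin n × Fin n)) where
  carrier := {ξ | ∀ i j, ξ (i, j) = ξ (j, i)}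
  add_mem' := by
    intro a b ha hb i j
    simp [ha i j, hb i j]
  zero_mem' := by
    intro i j
    simp
  smul_mem' := by
    intro c a ha i j
    simp [ha i j]

/-- The space of symmetric `n × n` matrices. -/
abbrev Sym (n : ℕ) := ↥(symSubmodule n)

/-- The symmetric part `(A + Aᵀ) / 2` of a square matrix. -/
def symPart {n : ℕ} (A : Fin n → Fin n → ℝ) : Sym n :=
  ⟨WithLp.toLp 2 fun k => (A k.1 k.2 + A k.2 k.1) / 2, by
    intro i j
    simp [add_comm]⟩

/-- The symmetrized tensor product `a ⊙ b`. -/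
def symTensor {n : ℕ} (a b : Vec n) : Sym n := symPart fun i j => a i * b j

/-- The symmetrized gradient `(∂ⱼ uᵢ + ∂ᵢ uⱼ) / 2`, where `G j = ∂ⱼ u`. -/
def symGrad {n : ℕ} (G : Fin n → Vec n) : Sym n := symPart fun i j => G j i

/-- The partial derivative `∂ᵢ φ (x)` of a smooth function. -/
def pderiv {n : ℕ} {F : Type*} [NormedAddCommGroup F] [NormedSpace ℝ F] (i : Fin n)
    (φ : Vec n → F) (x : Vec n) : F :=
  fderiv ℝ φ x (EuclideanSpace.single i 1)

/-- `φ ∈ C_c^∞(U; F)`. -/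
def IsTest {n : ℕ} {F : Type*} [NormedAddCommGroup F] [NormedSpace ℝ F]
    (U : Set (Vec n)) (φ : Vec n → F) : Prop :=
  ContDiff ℝ ∞ φ ∧ HasCompactSupport φ ∧ tsupport φ ⊆ U

/-! ### The domain, its boundary measure and its outer normal -/

/-- The `(n-1)`-dimensional Hausdorff measure on `ℝⁿ`, normalized so that it is the usual surface
measure. -/
abbrev surf (n : ℕ) : Measure (Vec n) := Measure.euclideanHausdorffMeasure (n - 1)

/-- Near each of its boundary points, `Ω` is the open subgraph, in some direction `d`, of a
Lipschitz function on the hyperplane orthogonal to `d`. -/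
def HasLipschitzBoundary {n : ℕ} (Ω : Set (Vec n)) : Prop :=
  ∀ x ∈ frontier Ω, ∃ (d : Vec n) (L : ℝ≥0) (h : ↥((ℝ ∙ d)ᗮ) → ℝ) (r : ℝ),
    ‖d‖ = 1 ∧ LipschitzWith L h ∧ 0 < r ∧
      ∀ y ∈ Metric.ball x r, y ∈ Ω ↔ ⟪d, y⟫ < h ((ℝ ∙ d)ᗮ.orthogonalProjectionOnto y)

/-- `ν` is the (measure theoretic) outer unit normal to `Ω` at `x`: the blow-ups of `Ω` at `x`
converge to the half space `{y | ⟪y, ν⟫ < 0}`. -/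
def IsOuterNormal {n : ℕ} (Ω : Set (Vec n)) (x ν : Vec n) : Prop :=
  ‖ν‖ = 1 ∧
  Tendsto (fun r : ℝ => volume (Metric.ball x r ∩ Ω ∩ {y | 0 < ⟪y - x, ν⟫}) /
    volume (Metric.ball x r)) (𝓝[>] 0) (𝓝 0) ∧
  Tendsto (fun r : ℝ => volume ((Metric.ball x r \ Ω) ∩ {y | ⟪y - x, ν⟫ < 0}) /
    volume (Metric.ball x r)) (𝓝[>] 0) (𝓝 0)

open Classical in
/-- The outer unit normal field; on a Lipschitz boundary it exists `ℋ^{n-1}`-a.e. -/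
def outerNormal {n : ℕ} (Ω : Set (Vec n)) (x : Vec n) : Vec n :=
  if h : ∃ ν, IsOuterNormal Ω x ν then h.choose else 0

/-! ### The spaces `BD` and `H¹` -/

/-- An element `u` of `BD(Ω)`, listed with the two objects it determines: its strain `Eu`,
a bounded Radon measure on `Ω`, and its trace on `∂Ω`, characterized by the Green formula
`∫_Ω φ d(Eu) + ∫_Ω u ⊙ ∇φ = ∫_{∂Ω} φ u ⊙ ν dℋ^{n-1}` for `φ ∈ C_c^∞(ℝⁿ)`. -/
structure BD {n : ℕ} (Ω : Set (Vec n)) where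
  toFun : Vec n → Vec n
  strain : VectorMeasure (Vec n) (Sym n)
  trace : Vec n → Vec n
  integrable : IntegrableOn toFun Ω
  strain_concentrated : ∀ A, Disjoint A Ω → strain A = 0
  strain_spec : ∀ φ : Vec n → ℝ, IsTest Ω φ →
    VectorMeasure.integral strain φ (ContinuousLinearMap.lsmul ℝ ℝ) =
      -∫ x in Ω, symTensor (toFun x) (gradient φ x)
  trace_integrable : IntegrableOn trace (frontier Ω) (surf n)
  trace_normal_integrable :
    IntegrableOn (fun x => symTensor (trace x) (outerNormal Ω x)) (frontier Ω) (surf n)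
  green : ∀ φ : Vec n → ℝ, IsTest univ φ →
    VectorMeasure.integral strain φ (ContinuousLinearMap.lsmul ℝ ℝ) +
        ∫ x in Ω, symTensor (toFun x) (gradient φ x) =
      ∫ x in frontier Ω, φ x • symTensor (trace x) (outerNormal Ω x) ∂(surf n)

/-- An element of `H¹(U; F)`, listed with its weak partial derivatives and with the trace on `∂Ω` of its
restriction to `Ω ⊆ U`, characterized by the Green formula. Used with `U = Ω` and `U = ℝⁿ`. -/
structure H1 {n : ℕ} (U Ω : Set (Vec n)) (F : Type*) [NormedAddCommGroup F]
    [NormedSpace ℝ F] where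
  toFun : Vec n → F
  grad : Fin n → Vec n → F
  trace : Vec n → F
  memLp : MemLp toFun 2 (volume.restrict U)
  grad_memLp : ∀ i, MemLp (grad i) 2 (volume.restrict U)
  grad_spec : ∀ φ : Vec n → ℝ, IsTest U φ → ∀ i,
    ∫ x in U, pderiv i φ x • toFun x = -∫ x in U, φ x • grad i x
  trace_integrable : IntegrableOn trace (frontier Ω) (surf n)
  trace_normal_integrable : ∀ i,
    IntegrableOn (fun x => outerNormal Ω x i • trace x) (frontier Ω) (surf n)
  green : ∀ φ : Vec n → ℝ, IsTest univ φ → ∀ i,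
    ∫ x in Ω, (φ x • grad i x + pderiv i φ x • toFun x) =
      ∫ x in frontier Ω, (φ x * outerNormal Ω x i) • trace x ∂(surf n)

/-! ### Capacity and quasicontinuous representatives -/

/-- `v ∈ W₀^{1,2}(Ω)` with gradient `Dv`: a limit in `H¹(Ω)` of functions in `C_c^∞(Ω)`. -/
def IsW012 {n : ℕ} (Ω : Set (Vec n)) (v : Vec n → ℝ) (Dv : Fin n → Vec n → ℝ) : Prop :=
  MemLp v 2 (volume.restrict Ω) ∧ (∀ i, MemLp (Dv i) 2 (volume.restrict Ω)) ∧
    ∃ φ : ℕ → Vec n → ℝ, (∀ k, IsTest Ω (φ k)) ∧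
      Tendsto (fun k => eLpNorm (v - φ k) 2 (volume.restrict Ω)) atTop (𝓝 0) ∧
      ∀ i, Tendsto (fun k => eLpNorm (Dv i - pderiv i (φ k)) 2 (volume.restrict Ω)) atTop (𝓝 0)

/-- The `2`-capacity of `B` in `Ω`. -/
def cap2 {n : ℕ} (B Ω : Set (Vec n)) : ℝ≥0∞ :=
  ⨅ (v : Vec n → ℝ) (Dv : Fin n → Vec n → ℝ) (_ : IsW012 Ω v Dv)
    (_ : ∃ N, IsOpen N ∧ B ⊆ N ∧ ∀ᵐ x ∂(volume.restrict (N ∩ Ω)), 1 ≤ v x),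
    ∫⁻ x in Ω, ∑ i, ‖Dv i x‖ₑ ^ 2

/-- `a` is a `Cap₂`-quasicontinuous representative in `Ω` of `α`. -/
def IsQuasicontRep {n : ℕ} (Ω : Set (Vec n)) (α a : Vec n → ℝ) : Prop :=
  a =ᵐ[volume.restrict Ω] α ∧
    ∀ ε : ℝ≥0∞, 0 < ε → ∃ B, B ⊆ Ω ∧ cap2 B Ω < ε ∧ ContinuousOn a (Ω \ B)

/-! ### Matrix valued measures -/

/-- The density of the part of `p` that is absolutely continuous with respect to `μ`,
computed in an orthonormal basis of the space of symmetric matrices. -/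
def density {n : ℕ} (p : VectorMeasure (Vec n) (Sym n)) (μ : Measure (Vec n)) (x : Vec n) :
    Sym n :=
  ∑ k, SignedMeasure.rnDeriv
    (p.mapRange (innerSL ℝ (stdOrthonormalBasis ℝ (Sym n) k)).toLinearMap.toAddMonoidHom
      (innerSL ℝ (stdOrthonormalBasis ℝ (Sym n) k)).continuous) μ x •
    stdOrthonormalBasis ℝ (Sym n) k

/-- The Lebesgue density of the absolutely continuous part of `p`. -/
def acDensity {n : ℕ} (p : VectorMeasure (Vec n) (Sym n)) : Vec n → Sym n :=
  density p volume

/-- The singular part `p^s` of `p` with respect to the Lebesgue measure. -/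
def singPart {n : ℕ} (p : VectorMeasure (Vec n) (Sym n)) : VectorMeasure (Vec n) (Sym n) :=
  p - volume.withDensityᵥ (acDensity p)

/-! ### Functions of time -/

/-- Absolute continuity on `[0, T]` of a curve `c`, with respect to the distance `dst`. -/
def IsAC {X : Type*} (dst : X → X → ℝ≥0∞) (T : ℝ) (c : ℝ → X) : Prop :=
  ∀ ε : ℝ≥0∞, 0 < ε → ∃ δ : ℝ, 0 < δ ∧ ∀ (N : ℕ) (a b : ℕ → ℝ),
    (∀ i < N, 0 ≤ a i ∧ a i ≤ b i ∧ b i ≤ T) →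
    (∀ i < N, ∀ j < N, i ≠ j → Disjoint (Ioo (a i) (b i)) (Ioo (a j) (b j))) →
    ∑ i ∈ Finset.range N, (b i - a i) < δ →
    ∑ i ∈ Finset.range N, dst (c (b i)) (c (a i)) < ε

/-- The variation on `[s, t]` of a curve `p` with respect to the size `c` of increments: the
supremum over the partitions `s = τ₀ < ⋯ < τ_N = t` of `∑ c (p τ_{j+1} - p τ_j)`. -/
def timeVariation {X : Type*} [Sub X] (c : X → ℝ≥0∞) (p : ℝ → X) (s t : ℝ) : ℝ≥0∞ :=
  ⨆ (N : ℕ) (τ : ℕ → ℝ) (_ : τ 0 = s ∧ τ N = t ∧ ∀ j < N, τ j < τ (j + 1)),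
    ∑ j ∈ Finset.range N, c (p (τ (j + 1)) - p (τ j))

/-! ### Divergence and traction -/

/-- `div σ = d` in the sense of distributions on `Ω`. -/
def HasWeakDiv {n : ℕ} (Ω : Set (Vec n)) (σ : Vec n → Sym n) (d : Vec n → Vec n) : Prop :=
  ∀ φ : Vec n → Vec n, IsTest Ω φ →
    ∫ x in Ω, ⟪σ x, symGrad fun i => pderiv i φ x⟫ = -∫ x in Ω, ⟪d x, φ x⟫

/-- The distribution `[σν]` on `∂Ω`, for `d = div σ`:
`⟨[σν], ψ⟩ = ∫_Ω div σ · ψ + ∫_Ω σ : Eψ`. -/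
def normalTrace {n : ℕ} {Ω : Set (Vec n)} (σ : Vec n → Sym n) (d : Vec n → Vec n)
    (ψ : H1 Ω Ω (Vec n)) : ℝ :=
  (∫ x in Ω, ⟪d x, ψ.toFun x⟫) + ∫ x in Ω, ⟪σ x, symGrad fun i => ψ.grad i x⟫

/-- `[σν] = g` on the part `ΓN` of `∂Ω`, for `d = div σ`: the equality is tested with all
`ψ ∈ H¹(Ω; ℝⁿ)` whose trace vanishes on the complementary part `ΓD`. -/
def HasTraction {n : ℕ} (Ω ΓD ΓN : Set (Vec n)) (σ : Vec n → Sym n) (d g : Vec n → Vec n) :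
    Prop :=
  ∀ ψ : H1 Ω Ω (Vec n), (∀ᵐ x ∂((surf n).restrict ΓD), ψ.trace x = 0) →
    normalTrace σ d ψ = ∫ x in ΓN, ⟪g x, ψ.trace x⟫ ∂(surf n)

/-! ### The constitutive model -/

/-- The reference configuration and the constitutive functions. -/
structure Model (n : ℕ) where
  /-- the reference configuration -/
  Ω : Set (Vec n)
  /-- the Dirichlet part of the boundary -/
  ΓD : Set (Vec n)
  /-- the Neumann part of the boundary -/
  ΓN : Set (Vec n)
  /-- the elasticity tensor -/
  C : Sym n →L[ℝ] Sym n
  /-- the hardening tensor, a function on `[0, 1)`; formally it is `+∞` at `1`, and its value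
  there is never used -/
  C1 : ℝ → Sym n →L[ℝ] Sym n
  /-- the constraint set -/
  K : Set (Sym n)
  /-- the damage dissipation -/
  D : Lp ℝ 1 (volume.restrict Ω) → ℝ

namespace Model

variable {n : ℕ}

/-- The standing assumptions on the reference configuration and the constitutive functions. -/
structure Standing (M : Model n) : Prop where
  isOpen : IsOpen M.Ω
  bounded : Bornology.IsBounded M.Ω
  connected : IsConnected M.Ω
  lipschitz : HasLipschitzBoundary M.Ω
  dirichlet_nonempty : M.ΓD.Nonempty
  dirichlet_relOpen : ∃ O, IsOpen O ∧ M.ΓD = O ∩ frontier M.Ω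
  neumann_relOpen : ∃ O, IsOpen O ∧ M.ΓN = O ∩ frontier M.Ω
  disjoint : Disjoint M.ΓD M.ΓN
  same_boundary : closure M.ΓD \ M.ΓD = closure M.ΓN \ M.ΓN
  cover : frontier M.Ω = M.ΓD ∪ M.ΓN ∪ (closure M.ΓD \ M.ΓD)
  boundary_finite : Measure.euclideanHausdorffMeasure (n - 2) (closure M.ΓD \ M.ΓD) < ⊤
  C_symm : ∀ ξ ζ, ⟪M.C ξ, ζ⟫ = ⟪ξ, M.C ζ⟫
  C_bounds : ∃ γ₁ γ₂ : ℝ, 0 < γ₁ ∧ 0 < γ₂ ∧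
    ∀ ξ, γ₁ * ‖ξ‖ ^ 2 ≤ ⟪M.C ξ, ξ⟫ ∧ ⟪M.C ξ, ξ⟫ ≤ γ₂ * ‖ξ‖ ^ 2
  C1_symm : ∀ a ∈ Ico (0 : ℝ) 1, ∀ ξ ζ, ⟪M.C1 a ξ, ζ⟫ = ⟪ξ, M.C1 a ζ⟫
  C1_cont : ContinuousOn M.C1 (Ico 0 1)
  C1_coercive : ∃ γ : ℝ → ℝ, MonotoneOn γ (Icc 0 1) ∧
    (∀ a ∈ Icc (0 : ℝ) 1, 0 ≤ γ a ∧ (γ a = 0 ↔ a = 0)) ∧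
    ∀ a ∈ Ico (0 : ℝ) 1, ∀ ξ, γ a * ‖ξ‖ ^ 2 ≤ ⟪M.C1 a ξ, ξ⟫
  C1_eq_zero : ∀ a ∈ Ico (0 : ℝ) 1, M.C1 a = 0 ↔ a = 0
  C1_mono : ∀ ξ, MonotoneOn (fun a => ⟪M.C1 a ξ, ξ⟫) (Ico 0 1)
  C1_blowup : ∀ R : ℝ, ∃ δ > 0, ∀ a ∈ Ioo (1 - δ) 1, 0 ≤ a → ∀ ξ,
    R * ‖ξ‖ ^ 2 ≤ ⟪M.C1 a ξ, ξ⟫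
  K_closed : IsClosed M.K
  K_convex : Convex ℝ M.K
  K_ball : ∃ r > 0, Metric.closedBall 0 r ⊆ M.K
  D_cont : Continuous M.D
  D_nonneg : ∀ α, 0 ≤ M.D α

/-- `(u, e, p) ∈ A(w)`: the admissible displacements and strains for the boundary datum `w`. -/
structure Admissible (M : Model n) (w : H1 univ M.Ω (Vec n)) (u : BD M.Ω) (e : Vec n → Sym n)
    (p : VectorMeasure (Vec n) (Sym n)) : Prop where
  e_memLp : MemLp e 2 (volume.restrict M.Ω)
  p_concentrated : ∀ A, Disjoint A (M.Ω ∪ M.ΓD) → p A = 0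
  strain_eq : ∀ A, MeasurableSet A → A ⊆ M.Ω → u.strain A = (∫ x in A, e x) + p A
  boundary_eq : ∀ A, MeasurableSet A → A ⊆ M.ΓD →
    p A = ∫ x in A, symTensor (w.trace x - u.trace x) (outerNormal M.Ω x) ∂(surf n)

/-- The elastic energy `𝒬`. -/
def elastic (M : Model n) (e : Vec n → Sym n) : ℝ := 1 / 2 * ∫ x in M.Ω, ⟪M.C (e x), e x⟫

open Classical in
/-- `D(α)`; on the bounded set `Ω` every function in `H¹` is integrable. -/
def damage (M : Model n) (α : H1 M.Ω M.Ω ℝ) : ℝ :=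
  if h : Integrable α.toFun (volume.restrict M.Ω) then M.D h.toL1 else 0

/-- `‖∇α‖²` in `L²`. -/
def gradEnergy (M : Model n) (α : H1 M.Ω M.Ω ℝ) : ℝ := ∫ x in M.Ω, ∑ i, α.grad i x ^ 2

open Classical in
/-- The hardening energy `Q̃(α, p)`. It is finite only if `p^s` does not charge the set in
`Ω ∪ ΓD` where the quasicontinuous representative (in `Ω`) or the trace (on `ΓD`) of `α` is
positive, and if `p` vanishes on `{α = 1}`. -/
def hardening (M : Model n) (α : H1 M.Ω M.Ω ℝ) (p : VectorMeasure (Vec n) (Sym n)) : ℝ≥0∞ :=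
  if (∃ a, IsQuasicontRep M.Ω α.toFun a ∧
        (singPart p).variation ({x ∈ M.Ω | 0 < a x} ∪ {x ∈ M.ΓD | 0 < α.trace x}) = 0) ∧
      (∀ᵐ x ∂(volume.restrict M.Ω), α.toFun x = 1 → acDensity p x = 0)
  then ∫⁻ x in {x ∈ M.Ω | α.toFun x ≠ 1},
    ENNReal.ofReal ⟪M.C1 (α.toFun x) (acDensity p x), acDensity p x⟫
  else ⊤

/-- The support function `H` of `K`, with values in `[0, ∞]` (note that `0 ∈ K`). -/
def supportFn (M : Model n) (ξ : Sym n) : ℝ≥0∞ := ⨆ σ ∈ M.K, ENNReal.ofReal ⟪σ, ξ⟫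

/-- The plastic potential `ℋ(p) = ∫ H(dp/d|p|) d|p|`, with values in `[0, ∞]`. -/
def plastic (M : Model n) (p : VectorMeasure (Vec n) (Sym n)) : ℝ≥0∞ :=
  ∫⁻ x, M.supportFn (density p p.variation x) ∂p.variation

/-- The work of the volume force `f` and the traction `g` on a displacement `v` with trace `τ`. -/
def work (M : Model n) (f g v τ : Vec n → Vec n) : ℝ :=
  (∫ x in M.Ω, ⟪f x, v x⟫) + ∫ x in M.ΓN, ⟪g x, τ x⟫ ∂(surf n)

/-- The duality `⟨[ϱ : p], φ⟩` between a stress `ϱ` with `-div ϱ = f` and `[ϱν] = g` on `ΓN`, and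
the plastic strain `p` of a triple `(u, e, p) ∈ A(w)`. For smooth `ϱ` it is `∫ φ ϱ : dp`. -/
def stressStrain (M : Model n) (ϱ : Vec n → Sym n) (f g : Vec n → Vec n)
    (w : H1 univ M.Ω (Vec n)) (u : BD M.Ω) (e : Vec n → Sym n) (φ : Vec n → ℝ) : ℝ :=
  (-∫ x in M.Ω, φ x * ⟪ϱ x, e x - symGrad fun i => w.grad i x⟫)
    - (∫ x in M.Ω, ⟪ϱ x, symTensor (u.toFun x - w.toFun x) (gradient φ x)⟫)
    + (∫ x in M.Ω, φ x * ⟪f x, u.toFun x - w.toFun x⟫)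
    + ∫ x in M.ΓN, φ x * ⟪g x, u.trace x - w.trace x⟫ ∂(surf n)

end Model

/-! ### Loading, states and evolutions -/

/-- The time interval `[0, T]`, the boundary displacement `w`, the volume force `f` and the
traction `g`. -/
structure Loading {n : ℕ} (M : Model n) where
  T : ℝ
  w : ℝ → H1 univ M.Ω (Vec n)
  f : ℝ → Vec n → Vec n
  g : ℝ → Vec n → Vec n

/-- A configuration: damage, displacement, elastic strain and plastic strain. -/
structure State {n : ℕ} (M : Model n) where
  α : H1 M.Ω M.Ω ℝ
  u : BD M.Ω
  e : Vec n → Sym n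
  p : VectorMeasure (Vec n) (Sym n)

namespace Loading

variable {n : ℕ} {M : Model n}

/-- The safe load condition. The conditions on the normal trace and on the duality with plastic
strains are required only in the presence of Neumann boundary conditions. -/
def SafeLoad (L : Loading M) : Prop :=
  ∃ (ϱ : ℝ → Vec n → Sym n) (τ₀ : ℝ), 0 < τ₀ ∧
    (∀ t ∈ Icc 0 L.T, MemLp (ϱ t) n (volume.restrict M.Ω)) ∧
    IsAC (fun a b => eLpNorm (a - b) n (volume.restrict M.Ω)) L.T ϱ ∧
    (∀ t ∈ Icc 0 L.T, HasWeakDiv M.Ω (ϱ t) (-L.f t)) ∧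
    (∀ t ∈ Icc 0 L.T, ∀ᵐ x ∂(volume.restrict M.Ω), ∀ τ : Sym n, ‖τ‖ ≤ τ₀ → ϱ t x + τ ∈ M.K) ∧
    (M.ΓN.Nonempty →
      (∀ t ∈ Icc 0 L.T, HasTraction M.Ω M.ΓD M.ΓN (ϱ t) (-L.f t) (L.g t)) ∧
      ∃ R : ℝ, 0 < R ∧ ∀ t ∈ Icc 0 L.T, ∀ w u e p, M.Admissible w u e p →
        ∀ φ : Vec n → ℝ, IsTest univ φ →
          |M.stressStrain (ϱ t) (L.f t) (L.g t) w u e φ| ≤ R * ∫ x, |φ x| ∂p.variation)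

/-- The standing assumptions on the loading. -/
structure Standing (L : Loading M) : Prop where
  T_pos : 0 < L.T
  w_ac : IsAC (fun a b : H1 univ M.Ω (Vec n) =>
    eLpNorm (a.toFun - b.toFun) 2 volume + ∑ i, eLpNorm (a.grad i - b.grad i) 2 volume) L.T L.w
  f_memLp : ∀ t ∈ Icc 0 L.T, MemLp (L.f t) n volume
  f_ac : IsAC (fun a b : Vec n → Vec n => eLpNorm (a - b) n volume) L.T L.f
  g_memLp : ∀ t ∈ Icc 0 L.T, MemLp (L.g t) ⊤ ((surf n).restrict M.ΓN)
  g_ac : IsAC (fun a b : Vec n → Vec n => eLpNorm (a - b) ⊤ ((surf n).restrict M.ΓN)) L.T L.g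
  safe : L.SafeLoad

/-- The total energy at time `t`, including the work of the loads:
`𝒬(e) + D(α) + ‖∇α‖² + Q̃(α, p) - ⟨ℒ(t), u⟩`. -/
def energy (L : Loading M) (t : ℝ) (s : State M) : EReal :=
  ((M.elastic s.e + M.damage s.α + M.gradEnergy s.α
      - M.work (L.f t) (L.g t) s.u.toFun s.u.trace : ℝ) : EReal) + (M.hardening s.α s.p : EReal)

/-- Admissibility and global stability of a state at time `t`. -/
def Stable (L : Loading M) (t : ℝ) (s : State M) : Prop :=
  M.Admissible (L.w t) s.u s.e s.p ∧
  ∀ s' : State M,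
    (∀ᵐ x ∂(volume.restrict M.Ω), 0 ≤ s'.α.toFun x ∧ s'.α.toFun x ≤ s.α.toFun x) →
    M.Admissible (L.w t) s'.u s'.e s'.p →
    L.energy t s ≤ L.energy t s' + (M.plastic (s'.p - s.p) : EReal)

/-- The power `⟨σ, Eẇ⟩` at time `r`, for the state `s` with `σ = ℂe`. Since `w` is absolutely
continuous in `H¹`, for a.e. `r` this is the derivative of the pairing with `Ew`. -/
def boundaryPower (L : Loading M) (s : State M) (r : ℝ) : ℝ :=
  deriv (fun r' => ∫ x in M.Ω, ⟪M.C (s.e x), symGrad fun i => (L.w r').grad i x⟫) r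

/-- `⟨ℒ̇, u⟩ + ⟨ℒ, ẇ⟩` at time `r`, for the state `s`; as above, the time derivatives are those of
the pairings. -/
def loadPower (L : Loading M) (s : State M) (r : ℝ) : ℝ :=
  deriv (fun r' => M.work (L.f r') (L.g r') s.u.toFun s.u.trace) r +
    deriv (fun r' => M.work (L.f r) (L.g r) (L.w r').toFun (L.w r').trace) r

/-- The initial datum `s₀` is admissible and stable. -/
structure InitialDatum (L : Loading M) (s₀ : State M) : Prop where
  range : ∀ᵐ x ∂(volume.restrict M.Ω), s₀.α.toFun x ∈ Icc (0 : ℝ) 1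
  stable : L.Stable 0 s₀

/-- Energetic solutions on `[0, T]`, with initial datum `s₀`: irreversibility of the damage,
global stability and energy-dissipation balance. -/
structure Evolution (L : Loading M) (s₀ : State M) (s : ℝ → State M) : Prop where
  range : ∀ t ∈ Icc 0 L.T, ∀ᵐ x ∂(volume.restrict M.Ω), (s t).α.toFun x ∈ Icc (0 : ℝ) 1
  irreversible : ∀ t₁ ∈ Icc 0 L.T, ∀ t₂ ∈ Icc 0 L.T, t₁ ≤ t₂ →
    ∀ᵐ x ∂(volume.restrict M.Ω), (s t₂).α.toFun x ≤ (s t₁).α.toFun x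
  stable : ∀ t ∈ Icc 0 L.T, L.Stable t (s t)
  bounded_variation :
    timeVariation (fun q => q.variation univ) (fun r => (s r).p) 0 L.T < ⊤
  power_integrable : IntervalIntegrable (fun r => L.boundaryPower (s r) r) volume 0 L.T ∧
    IntervalIntegrable (fun r => L.loadPower (s r) r) volume 0 L.T
  balance : ∀ t ∈ Icc 0 L.T,
    L.energy t (s t) + (timeVariation M.plastic (fun r => (s r).p) 0 t : EReal) =
      L.energy 0 s₀ +
        (((∫ r in (0 : ℝ)..t, L.boundaryPower (s r) r) -
          ∫ r in (0 : ℝ)..t, L.loadPower (s r) r : ℝ) : EReal)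

end Loading

end GeoPlast

end

noncomputable section

namespace GeoPlast

variable {n : ℕ}

/-! ### Symmetric matrices -/

/-! All three conclusions are first-order conditions for global stability at one fixed time: the
stable state is compared with competitors that keep the damage and depend affinely on a small
parameter.

Equilibrium and traction. Take `ψ ∈ H¹` with zero trace on the Dirichlet part and replace `(u, e,
p)` by `(u + cψ, e + cEψ, p)`. Since `p` is kept, hardening and dissipation cancel, and what remains
is a polynomial in `c` with a linear and a quadratic term. Both signs of `c` give `∫ σ : Eψ = ⟨ℒ,
ψ⟩` (`Stable.virtual_work`). Test fields in `Ω` yield the equation, general `ψ` the traction.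

Stress constraint. Exchange elastic for plastic strain: replace `(u, e, p)` by `(u, e - ε 1_A ξ, p +
ε 1_A ξ dx)`, where `A` lies in a set on which `α` is bounded away from `1` and `p^a` is bounded. If
`σ : ξ ≤ c` for all `σ ∈ K`, the dissipated energy is at most `ε c |A|`. Dividing by `ε` and letting
`ε → 0` gives `∫_A (σ - 2ℂ₁(α)p^a) : ξ ≤ c |A|`; the `2` appears because `Q̃`, unlike `𝒬`, carries
no factor `1/2`. As `A` is arbitrary, the inequality holds a.e. (`Stable.ae_inner_le`), and
countably many half-spaces cut out `K`.

Two facts make these expansions legitimate. The hardening energy of a stable state is finite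
(compare with zero damage, `Stable.hardening_ne_top`), so it can be subtracted. The work is linear
along `u + cψ`, which needs `f · u` integrable for `f ∈ L^n`, that is, the embedding `BD ⊂
L^{n/(n-1)}` (`BD.memLp`). The embedding is proved by a Gagliardo argument along oblique bases,
because a symmetrized gradient controls only the derivatives of `u · ξ` in the direction `ξ`. -/

lemma sym_inner_eq (σ τ : Sym n) : ⟪σ, τ⟫ = ∑ k, σ.1 k * τ.1 k := by
  rw [Submodule.coe_inner, PiLp.inner_apply]
  exact Finset.sum_congr rfl fun k _ => by simp [mul_comm]

lemma symPart_apply (A : Fin n → Fin n → ℝ) (i j : Fin n) :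
    (symPart A).1 (i, j) = (A i j + A j i) / 2 := rfl

lemma sym_ext {σ τ : Sym n} (h : ∀ i j, σ.1 (i, j) = τ.1 (i, j)) : σ = τ := by
  apply Subtype.ext
  ext ⟨i, j⟩
  exact h i j

/-- The symmetrized tensor product as a continuous bilinear map. -/
def symTensorL : Vec n →L[ℝ] Vec n →L[ℝ] Sym n :=
  LinearMap.toContinuousBilinearMap <| LinearMap.mk₂ ℝ symTensor
    (fun a a' b => sym_ext fun i j => by simp [symTensor, symPart_apply]; ring)
    (fun c a b => sym_ext fun i j => by simp [symTensor, symPart_apply]; ring)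
    (fun a b b' => sym_ext fun i j => by simp [symTensor, symPart_apply]; ring)
    (fun c a b => sym_ext fun i j => by simp [symTensor, symPart_apply]; ring)

@[simp] lemma symTensorL_apply (a b : Vec n) : symTensorL a b = symTensor a b := rfl

/-- The symmetrized gradient as a continuous linear map. -/
def symGradL : (Fin n → Vec n) →L[ℝ] Sym n :=
  LinearMap.toContinuousLinearMap
    { toFun := symGrad
      map_add' := fun a b => sym_ext fun i j => by simp [symGrad, symPart_apply]; ring
      map_smul' := fun c a => sym_ext fun i j => by simp [symGrad, symPart_apply]; ring }

@[simp] lemma symGradL_apply (G : Fin n → Vec n) : symGradL G = symGrad G := rfl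

lemma symGrad_eq_sum (G : Fin n → Vec n) :
    symGrad G = ∑ k, symTensor (G k) (EuclideanSpace.single k 1) := by
  refine sym_ext fun i j => ?_
  simp only [symGrad, symTensor, AddSubmonoidClass.coe_finsetSum, WithLp.ofLp_sum, Finset.sum_apply,
    symPart_apply]
  rw [← Finset.sum_div, Finset.sum_add_distrib]
  simp

lemma symTensor_eq_sum (a b : Vec n) :
    symTensor a b = ∑ k, b k • symTensor a (EuclideanSpace.single k 1) := by
  have hb : b = ∑ k, b k • EuclideanSpace.single k (1 : ℝ) := by
    ext i; simp [Pi.single_apply]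
  conv_lhs => rw [hb]
  rw [← symTensorL_apply, map_sum]
  simp

/-- With `b = ∇φ` the right side is `(a · ξ) ∂_ξ φ`: testing a strain with `ξ ⊙ ξ` isolates the
derivative of the component along `ξ` in the same direction `ξ`. -/
lemma inner_symTensor_self (a b ξ : Vec n) :
    ⟪symTensor a b, symTensor ξ ξ⟫ = ⟪a, ξ⟫ * ⟪b, ξ⟫ := by
  rw [sym_inner_eq, Fintype.sum_prod_type, PiLp.inner_apply, PiLp.inner_apply]
  simp only [symTensor, symPart_apply, RCLike.inner_apply, conj_trivial]
  rw [Finset.sum_mul_sum]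
  have h : ∀ i j, (a i * b j + a j * b i) / 2 * ((ξ i * ξ j + ξ j * ξ i) / 2) =
      1 / 2 * (ξ i * a i * (ξ j * b j)) + 1 / 2 * (ξ j * a j * (ξ i * b i)) := by
    intro i j; ring
  simp only [h, Finset.sum_add_distrib]
  rw [Finset.sum_comm (f := fun i j => 1 / 2 * (ξ j * a j * (ξ i * b i)))]
  simp only [← Finset.mul_sum]
  ring

lemma gradient_apply (φ : Vec n → ℝ) (x : Vec n) (k : Fin n) :
    gradient φ x k = pderiv k φ x := by
  have h : ⟪gradient φ x, EuclideanSpace.single k (1 : ℝ)⟫ = fderiv ℝ φ x (EuclideanSpace.single k 1) := by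
    simp [gradient, InnerProductSpace.toDual_symm_apply]
  rw [pderiv, ← h, EuclideanSpace.inner_single_right]
  simp

/-! ### Matrix valued measures -/

section VectorMeasures

variable {X : Type*} [MeasurableSpace X]

/-- The component of a vector measure in the direction `b`. -/
abbrev comp (p : VectorMeasure X (Sym n)) (b : Sym n) : SignedMeasure X :=
  p.mapRange (innerSL ℝ b).toLinearMap.toAddMonoidHom (innerSL ℝ b).continuous

lemma comp_apply (p : VectorMeasure X (Sym n)) (b : Sym n) (s : Set X) :
    comp p b s = ⟪b, p s⟫ := rfl

/-- Finite dimension is what matters: the variation is dominated by the sum of the total variations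
of the finitely many components, each of them a finite measure. -/
instance isFiniteMeasure_variation (p : VectorMeasure X (Sym n)) :
    IsFiniteMeasure p.variation := by
  set b := stdOrthonormalBasis ℝ (Sym n)
  have h : p.variation ≤ ∑ k, (comp p (b k)).totalVariation := by
    refine VectorMeasure.variation_le_of_forall_enorm_le fun s _ => ?_
    rw [Measure.finsetSum_apply]
    calc ‖p s‖ₑ = ‖∑ k, ⟪b k, p s⟫ • b k‖ₑ := by rw [b.sum_repr']
      _ ≤ ∑ k, ‖⟪b k, p s⟫ • b k‖ₑ := enorm_sum_le _ _
      _ ≤ ∑ k, (comp p (b k)).totalVariation s := by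
          refine Finset.sum_le_sum fun k _ => ?_
          rw [enorm_smul, enorm_eq_nnnorm (b k), b.nnnorm_eq_one]
          rw [ENNReal.coe_one, mul_one]
          exact (comp p (b k)).enorm_le_totalVariation s
  exact isFiniteMeasure_of_le _ h

variable {E : Type*} [NormedAddCommGroup E] [NormedSpace ℝ E] [CompleteSpace E]

/-- Induction on simple functions, then bounded simple approximations and dominated convergence on
both sides. This turns integrals against an absolutely continuous strain into Lebesgue integrals. -/
lemma integral_withDensityᵥ {μ : Measure X} {g : X → E} (hg : Integrable g μ) {φ : X → ℝ}
    (hφ : StronglyMeasurable φ) {C : ℝ} (hC : ∀ x, ‖φ x‖ ≤ C) :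
    VectorMeasure.integral (μ.withDensityᵥ g) φ (ContinuousLinearMap.lsmul ℝ ℝ) =
      ∫ x, φ x • g x ∂μ := by
  have hvar := Measure.variation_withDensityᵥ hg
  have hfin : IsFiniteMeasure (μ.withDensityᵥ g).variation := by
    rw [hvar]; exact isFiniteMeasure_withDensity hg.2.ne
  have hint : ∀ f : SimpleFunc X ℝ, Integrable (fun x => f x • g x) μ := fun f => by
    obtain ⟨D, hD⟩ := f.exists_forall_norm_le
    exact hg.bdd_smul D f.aestronglyMeasurable (ae_of_all _ hD)
  have hsimple : ∀ f : SimpleFunc X ℝ,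
      VectorMeasure.integral (μ.withDensityᵥ g) f (ContinuousLinearMap.lsmul ℝ ℝ) =
        ∫ x, f x • g x ∂μ := by
    intro f
    induction f using SimpleFunc.induction with
    | const c hs =>
      rename_i s
      rw [SimpleFunc.coe_piecewise]
      simp only [SimpleFunc.coe_const, Function.const_zero, piecewise_eq_indicator]
      change VectorMeasure.integral _ (s.indicator fun _ => c) _ =
        ∫ x, s.indicator (fun _ => c) x • g x ∂μ
      rw [VectorMeasure.integral_indicator hs, VectorMeasure.setIntegral_const,
        withDensityᵥ_apply hg hs]
      have e2 : (fun x => s.indicator (fun _ => c) x • g x) = s.indicator fun x => c • g x := by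
        ext x; by_cases hx : x ∈ s <;> simp [hx]
      rw [e2, integral_indicator hs, integral_smul]
      rfl
    | add _ hf hh =>
      rename_i f h _
      have hi : ∀ f : SimpleFunc X ℝ, (μ.withDensityᵥ g).Integrable f := fun f =>
        SimpleFunc.integrable_of_isFiniteMeasure f
      rw [SimpleFunc.coe_add, VectorMeasure.integral_add (hi f) (hi h), hf, hh,
        ← integral_add (hint f) (hint h)]
      simp [add_smul]
  have h1 : Tendsto (fun k => VectorMeasure.integral (μ.withDensityᵥ g) (hφ.approxBounded C k)
      (ContinuousLinearMap.lsmul ℝ ℝ)) atTop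
      (𝓝 (VectorMeasure.integral (μ.withDensityᵥ g) φ (ContinuousLinearMap.lsmul ℝ ℝ))) := by
    refine VectorMeasure.tendsto_integral_of_dominated_convergence (fun _ => C)
      (fun k => (hφ.approxBounded C k).aestronglyMeasurable) (integrable_const C)
      (fun k => ae_of_all _ fun x => ?_)
      (ae_of_all _ fun x => hφ.tendsto_approxBounded_of_norm_le (hC x))
    exact hφ.norm_approxBounded_le ((norm_nonneg _).trans (hC x)) k x
  have h2 : Tendsto (fun k => ∫ x, hφ.approxBounded C k x • g x ∂μ) atTop
      (𝓝 (∫ x, φ x • g x ∂μ)) := by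
    refine tendsto_integral_of_dominated_convergence (fun x => C * ‖g x‖)
      (fun k => (hint _).aestronglyMeasurable) (hg.norm.const_mul C)
      (fun k => ae_of_all _ fun x => ?_)
      (ae_of_all _ fun x => (hφ.tendsto_approxBounded_of_norm_le (hC x)).smul_const _)
    rw [norm_smul]
    gcongr
    exact hφ.norm_approxBounded_le ((norm_nonneg _).trans (hC x)) k x
  simp only [hsimple] at h1
  exact tendsto_nhds_unique h1 h2

lemma comp_withDensityᵥ {μ : Measure X} {g : X → Sym n} (hg : Integrable g μ) (b : Sym n) :
    comp (μ.withDensityᵥ g) b = μ.withDensityᵥ fun x => ⟪b, g x⟫ := by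
  ext s hs
  rw [comp_apply, withDensityᵥ_apply hg hs, withDensityᵥ_apply (hg.const_inner b) hs,
    integral_inner hg.integrableOn]

lemma rnDeriv_withDensityᵥ {μ : Measure X} {g : X → ℝ} (hg : Integrable g μ) :
    SignedMeasure.rnDeriv (μ.withDensityᵥ g) μ =ᵐ[μ] g :=
  (SignedMeasure.eq_rnDeriv 0 g hg VectorMeasure.MutuallySingular.zero_left (zero_add _).symm).symm

end VectorMeasures

/-- Componentwise uniqueness of the Lebesgue decomposition. It serves both with Lebesgue measure and
with a variation measure, where the density is the polar factor. -/
lemma density_withDensityᵥ {μ : Measure (Vec n)} {g : Vec n → Sym n} (hg : Integrable g μ) :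
    density (μ.withDensityᵥ g) μ =ᵐ[μ] g := by
  set b := stdOrthonormalBasis ℝ (Sym n)
  have h : ∀ᵐ x ∂μ, ∀ k, (comp (μ.withDensityᵥ g) (b k)).rnDeriv μ x = ⟪b k, g x⟫ := by
    rw [ae_all_iff]
    intro k
    rw [comp_withDensityᵥ hg]
    exact rnDeriv_withDensityᵥ (hg.const_inner (b k))
  filter_upwards [h] with x hx
  calc density (μ.withDensityᵥ g) μ x = ∑ k, ⟪b k, g x⟫ • b k :=
        Finset.sum_congr rfl fun k _ => by rw [← hx k]
    _ = g x := b.sum_repr' (g x)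

lemma density_add (p q : VectorMeasure (Vec n) (Sym n)) (μ : Measure (Vec n)) [SigmaFinite μ] :
    density (p + q) μ =ᵐ[μ] density p μ + density q μ := by
  set b := stdOrthonormalBasis ℝ (Sym n)
  have h : ∀ᵐ x ∂μ, ∀ k, (comp (p + q) (b k)).rnDeriv μ x =
      (comp p (b k)).rnDeriv μ x + (comp q (b k)).rnDeriv μ x := by
    rw [ae_all_iff]
    intro k
    have e : comp (p + q) (b k) = comp p (b k) + comp q (b k) := VectorMeasure.mapRange_add _
    rw [e]
    exact SignedMeasure.rnDeriv_add _ _ _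
  filter_upwards [h] with x hx
  simp only [density, Pi.add_apply, ← Finset.sum_add_distrib, ← add_smul]
  exact Finset.sum_congr rfl fun k _ => by rw [← hx k]

lemma measurable_density (p : VectorMeasure (Vec n) (Sym n)) (μ : Measure (Vec n)) :
    Measurable (density p μ) :=
  Finset.measurable_sum _ fun _ _ => (SignedMeasure.measurable_rnDeriv _ _).smul_const _

lemma integrable_density (p : VectorMeasure (Vec n) (Sym n)) (μ : Measure (Vec n)) :
    Integrable (density p μ) μ :=
  integrable_finsetSum _ fun _ _ => (SignedMeasure.integrable_rnDeriv _ _).smul_const _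

lemma acDensity_add_withDensityᵥ (p : VectorMeasure (Vec n) (Sym n)) {g : Vec n → Sym n}
    (hg : Integrable g volume) :
    acDensity (p + volume.withDensityᵥ g) =ᵐ[volume] acDensity p + g := by
  filter_upwards [density_add p (volume.withDensityᵥ g) volume, density_withDensityᵥ hg]
    with x h1 h2
  simp only [acDensity, h1, Pi.add_apply, h2]

/-- Hence an absolutely continuous perturbation of `p` cannot violate the capacitary condition in
the hardening energy. -/
lemma singPart_add_withDensityᵥ (p : VectorMeasure (Vec n) (Sym n)) {g : Vec n → Sym n}
    (hg : Integrable g volume) :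
    singPart (p + volume.withDensityᵥ g) = singPart p := by
  rw [singPart, WithDensityᵥEq.congr_ae (acDensity_add_withDensityᵥ p hg),
    withDensityᵥ_add (f := acDensity p) (integrable_density p volume) hg, singPart]
  exact add_sub_add_right_eq_sub _ _ _

/-! ### The embedding of `BD` into `L^{n/(n-1)}` -/

open scoped Convolution

lemma isClosedEmbedding_line (x : Vec n) {ξ : Vec n} (hξ : ξ ≠ 0) :
    IsClosedEmbedding fun s : ℝ => x + s • ξ :=
  (Homeomorph.addLeft x).isClosedEmbedding.comp (isClosedEmbedding_smul_left hξ)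

/-- The fundamental theorem of calculus on a half-line from `x` in the direction `ξ`, where compact
support removes the term at infinity. -/
lemma enorm_le_lintegral_line {v : Vec n → ℝ} (hv : ContDiff ℝ 1 v) (hvc : HasCompactSupport v)
    (x : Vec n) {ξ : Vec n} (hξ : ξ ≠ 0) :
    ‖v x‖ₑ ≤ ∫⁻ s : ℝ, ‖fderiv ℝ v (x + s • ξ) ξ‖ₑ := by
  have hd : ∀ s : ℝ, HasDerivAt (fun s : ℝ => x + s • ξ) ξ s := fun s => by
    simpa using ((hasDerivAt_id s).smul_const ξ).const_add x
  have h1 : ContDiff ℝ 1 fun s : ℝ => v (x + s • ξ) :=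
    hv.comp (contDiff_const.add (contDiff_id.smul contDiff_const))
  have h2 : HasCompactSupport fun s : ℝ => v (x + s • ξ) :=
    hvc.comp_isClosedEmbedding (isClosedEmbedding_line x hξ)
  have h3 := HasCompactSupport.enorm_le_lintegral_Ici_deriv h1 h2 0
  have h4 : ∀ s : ℝ, deriv (fun s : ℝ => v (x + s • ξ)) s = fderiv ℝ v (x + s • ξ) ξ := fun s =>
    (((hv.differentiable one_ne_zero) _).hasFDerivAt.comp_hasDerivAt s (hd s)).deriv
  simp only [zero_smul, add_zero, h4] at h3
  exact h3.trans (setLIntegral_le_lintegral _ _)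

/-- The derivative of `ρ ⋆ V` along `ξ` at `z` is the pairing of `V` with the derivative of the test
function `ρ(z - ·)`, up to sign; so `H` bounds it by the mollified measure at `z`, and the line
estimate for smooth functions applies. -/
lemma enorm_convolution_le_lintegral_line {V : Vec n → ℝ} (hV : Integrable V)
    (hVc : HasCompactSupport V) {ξ : Vec n} (hξ : ξ ≠ 0) {m : Measure (Vec n)}
    (H : ∀ φ : Vec n → ℝ, IsTest univ φ →
      ‖∫ x, V x * fderiv ℝ φ x ξ‖ₑ ≤ ∫⁻ x, ‖φ x‖ₑ ∂m)
    {ρ : Vec n → ℝ} (hρ : ContDiff ℝ ∞ ρ) (hρc : HasCompactSupport ρ) (x : Vec n) :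
    ‖(ρ ⋆[ContinuousLinearMap.lsmul ℝ ℝ] V) x‖ₑ ≤
      ∫⁻ s : ℝ, ∫⁻ y, ‖ρ (x + s • ξ - y)‖ₑ ∂m := by
  have hρ1 : ContDiff ℝ 1 ρ := hρ.of_le (by exact_mod_cast le_top)
  rw [← convolution_flip]
  set L := (ContinuousLinearMap.lsmul ℝ ℝ : ℝ →L[ℝ] ℝ →L[ℝ] ℝ).flip
  have hv : ContDiff ℝ 1 (V ⋆[L] ρ) := hρc.contDiff_convolution_right L hV.locallyIntegrable hρ1
  have hvc : HasCompactSupport (V ⋆[L] ρ) := hVc.convolution L hρc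
  refine (enorm_le_lintegral_line hv hvc x hξ).trans (lintegral_mono fun s => ?_)
  set z := x + s • ξ
  have hfd := hρc.hasFDerivAt_convolution_right L hV.locallyIntegrable hρ1 z
  have hex : ConvolutionExistsAt V (fderiv ℝ ρ) z (L.precompR (Vec n)) :=
    (hρc.fderiv ℝ).convolutionExists_right (L.precompR (Vec n)) hV.locallyIntegrable
      (hρ1.continuous_fderiv one_ne_zero) z
  set φ : Vec n → ℝ := fun y => ρ (z - y)
  have hφ : IsTest univ φ :=
    ⟨hρ.comp (contDiff_const.sub contDiff_id),
      hρc.comp_isClosedEmbedding (Homeomorph.subLeft z).isClosedEmbedding, subset_univ _⟩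
  have hφd : ∀ y, fderiv ℝ φ y ξ = -fderiv ℝ ρ (z - y) ξ := fun y => by
    have h := ((hρ1.differentiable one_ne_zero) (z - y)).hasFDerivAt.comp y
      ((hasFDerivAt_const z y).sub (hasFDerivAt_id y))
    have h' : HasFDerivAt φ _ y := h
    rw [h'.fderiv]
    simp
  have e : fderiv ℝ (V ⋆[L] ρ) z ξ = -∫ y, V y * fderiv ℝ φ y ξ := by
    rw [hfd.fderiv, convolution, ContinuousLinearMap.integral_apply hex, ← integral_neg]
    refine integral_congr_ae (ae_of_all _ fun y => ?_)
    simp [L, hφd, ContinuousLinearMap.precompR_apply, mul_comm]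
  rw [e, enorm_neg]
  exact H φ hφ

lemma lintegral_lintegral_enorm_sub {ρ : Vec n → ℝ} (hρ : Continuous ρ) (m : Measure (Vec n))
    [SFinite m] :
    ∫⁻ x, ∫⁻ y, ‖ρ (x - y)‖ₑ ∂m = (∫⁻ x, ‖ρ x‖ₑ) * m univ := by
  rw [lintegral_lintegral_swap (by fun_prop)]
  simp_rw [lintegral_sub_right_eq_self (fun x => ‖ρ x‖ₑ)]
  rw [lintegral_const]

/-- The grid-lines inequality with respect to an arbitrary basis. -/
lemma lintegral_prod_le_of_le_lintegral_line (hn : 2 ≤ n) (T : (Fin n → ℝ) ≃L[ℝ] Vec n) :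
    ∃ c c' : ℝ≥0, ∀ (h : Vec n → ℝ≥0∞) (v : Fin n → Vec n → ℝ), Measurable h →
      (∀ k x, ‖v k x‖ₑ ≤ ∫⁻ s : ℝ, h (x + s • T (Pi.single k 1))) →
      ∫⁻ x, ∏ k, ‖v k x‖ₑ ^ ((1 : ℝ) / (n - 1)) ≤
        c * (c' * ∫⁻ x, h x) ^ (Real.conjExponent n) := by
  -- Uniqueness of Haar measure compares Lebesgue measure with its image under `T`; the two scalar
  -- factors stand in for the Jacobian determinant, whose value is irrelevant.
  have hT := ContinuousLinearEquiv.isAddHaarMeasure_map T (volume : Measure (Fin n → ℝ))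
  set ν : Measure (Vec n) := Measure.map T volume
  set c := Measure.addHaarScalarFactor (volume : Measure (Vec n)) ν
  set c' := Measure.addHaarScalarFactor ν (volume : Measure (Vec n))
  have hc : (volume : Measure (Vec n)) = c • ν := Measure.isAddLeftInvariant_eq_smul _ _
  have hc' : ν = c' • (volume : Measure (Vec n)) := Measure.isAddLeftInvariant_eq_smul _ _
  have hmap : ∀ F : Vec n → ℝ≥0∞, ∫⁻ x, F x ∂ν = ∫⁻ y, F (T y) := fun F =>
    lintegral_map_equiv F T.toHomeomorph.toMeasurableEquiv
  refine ⟨c, c', fun h v hh hv => ?_⟩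
  have hp : Real.HolderConjugate (Fintype.card (Fin n)) (Real.conjExponent n) := by
    rw [Fintype.card_fin]
    exact Real.HolderConjugate.conjExponent (by exact_mod_cast hn)
  have hgrid := lintegral_prod_lintegral_pow_le (fun _ : Fin n => (volume : Measure ℝ)) hp
    (f := fun y => h (T y)) (hh.comp T.continuous.measurable)
  rw [Fintype.card_fin] at hgrid
  have hline : ∀ (k : Fin n) (y : Fin n → ℝ),
      ‖v k (T y)‖ₑ ≤ ∫⁻ s : ℝ, h (T (Function.update y k s)) := by
    intro k y
    refine (hv k (T y)).trans_eq ?_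
    rw [← lintegral_add_left_eq_self (fun s => h (T (Function.update y k s))) (y k)]
    refine lintegral_congr fun s => ?_
    congr 1
    rw [← map_smul, ← map_add]
    congr 1
    ext j
    rcases eq_or_ne j k with rfl | hj
    · simp
    · simp [hj]
  calc ∫⁻ x, ∏ k, ‖v k x‖ₑ ^ ((1 : ℝ) / (n - 1))
      = c * ∫⁻ y, ∏ k, ‖v k (T y)‖ₑ ^ ((1 : ℝ) / (n - 1)) := by
        rw [hc, lintegral_smul_measure, hmap]; rfl
    _ ≤ c * ∫⁻ y : Fin n → ℝ, ∏ k,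
          (∫⁻ s : ℝ, h (T (Function.update y k s))) ^ ((1 : ℝ) / (n - 1)) := by
        gcongr with y k
        · have : (2 : ℝ) ≤ n := by exact_mod_cast hn
          exact div_nonneg zero_le_one (by linarith)
        · exact hline k y
    _ ≤ c * (∫⁻ y : Fin n → ℝ, h (T y)) ^ Real.conjExponent n := by
        gcongr
        exact hgrid
    _ = c * (c' * ∫⁻ x, h x) ^ Real.conjExponent n := by
        rw [← hmap, hc', lintegral_smul_measure]; rfl

/-- If the symmetric part of the distributional derivative of `U` is a finite measure, then the
geometric mean of the components of `U` along a basis is in `L^{n/(n-1)}`. -/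
lemma lintegral_prod_inner_lt_top (hn : 2 ≤ n) (T : (Fin n → ℝ) ≃L[ℝ] Vec n) {U : Vec n → Vec n}
    (hU : Integrable U) (hUc : HasCompactSupport U) {m : Measure (Vec n)} [IsFiniteMeasure m]
    (H : ∀ k, ∀ φ : Vec n → ℝ, IsTest univ φ →
      ‖∫ x, ⟪U x, T (Pi.single k 1)⟫ * fderiv ℝ φ x (T (Pi.single k 1))‖ₑ ≤ ∫⁻ x, ‖φ x‖ₑ ∂m) :
    ∫⁻ x, ∏ k, ‖⟪U x, T (Pi.single k 1)⟫‖ₑ ^ ((1 : ℝ) / (n - 1)) < ⊤ := by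
  set ξ : Fin n → Vec n := fun k => T (Pi.single k 1)
  have hξ : ∀ k, ξ k ≠ 0 := fun k => by
    simp [ξ]
  have hr : (0 : ℝ) ≤ (1 : ℝ) / (n - 1) := by
    have : (2 : ℝ) ≤ n := by exact_mod_cast hn
    exact div_nonneg zero_le_one (by linarith)
  obtain ⟨c, c', hcc⟩ := lintegral_prod_le_of_le_lintegral_line hn T
  set V : Fin n → Vec n → ℝ := fun k x => ⟪U x, ξ k⟫
  have hV : ∀ k, Integrable (V k) := fun k => hU.inner_const (ξ k)
  have hVc : ∀ k, HasCompactSupport (V k) := fun k =>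
    hUc.comp_left (g := fun u => ⟪u, ξ k⟫) (by simp)
  -- Both radii shrink with ratio `2`: a bounded ratio is what the a.e. convergence of the
  -- mollifications requires.
  let ρ : ℕ → ContDiffBump (0 : Vec n) := fun j =>
    ⟨1 / ((j : ℝ) + 1), 2 / ((j : ℝ) + 1), by positivity, by
      gcongr; norm_num⟩
  have hρ0 : Tendsto (fun j => (ρ j).rOut) atTop (𝓝 0) := by
    have := (tendsto_one_div_add_atTop_nhds_zero_nat (𝕜 := ℝ)).const_mul 2
    simpa [ρ, div_eq_mul_inv] using this
  have hlim : ∀ᵐ x, ∀ k, Tendsto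
      (fun j => ((ρ j).normed volume ⋆[ContinuousLinearMap.lsmul ℝ ℝ] V k) x) atTop
      (𝓝 (V k x)) := by
    rw [ae_all_iff]
    intro k
    refine ContDiffBump.ae_convolution_tendsto_right_of_locallyIntegrable (K := 2) hρ0
      (Eventually.of_forall fun j => le_of_eq ?_) (hV k).locallyIntegrable
    simp only [ρ]
    ring
  -- Mollifying with a kernel of integral one keeps the mass `m univ`, so the grid-lines bound does
  -- not depend on `j`.
  have hbound : ∀ j, ∫⁻ x, ∏ k,
      ‖((ρ j).normed volume ⋆[ContinuousLinearMap.lsmul ℝ ℝ] V k) x‖ₑ ^ ((1 : ℝ) / (n - 1)) ≤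
        c * (c' * m univ) ^ Real.conjExponent n := by
    intro j
    have hcont : Continuous ((ρ j).normed volume) := (ρ j).continuous_normed
    have h1 : ∫⁻ x, ‖(ρ j).normed volume x‖ₑ = 1 := by
      have : ∀ x, ‖(ρ j).normed volume x‖ₑ = ENNReal.ofReal ((ρ j).normed volume x) := fun x =>
        Real.enorm_of_nonneg ((ρ j).nonneg_normed x)
      simp_rw [this]
      rw [← ofReal_integral_eq_lintegral_ofReal (ρ j).integrable_normed
        (ae_of_all _ (ρ j).nonneg_normed), (ρ j).integral_normed, ENNReal.ofReal_one]
    have h2 := hcc (fun x => ∫⁻ y, ‖(ρ j).normed volume (x - y)‖ₑ ∂m)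
      (fun k => (ρ j).normed volume ⋆[ContinuousLinearMap.lsmul ℝ ℝ] V k)
      (Measurable.lintegral_prod_right
        (hcont.measurable.comp (measurable_fst.sub measurable_snd)).enorm)
      fun k x => enorm_convolution_le_lintegral_line (hV k) (hVc k) (hξ k) (H k)
        (ρ j).contDiff_normed (ρ j).hasCompactSupport_normed x
    rwa [lintegral_lintegral_enorm_sub hcont, h1, one_mul] at h2
  have hfin : (c : ℝ≥0∞) * (c' * m univ) ^ Real.conjExponent n < ⊤ := by
    have hp : 0 ≤ Real.conjExponent n :=
      (Real.HolderConjugate.conjExponent (show (1 : ℝ) < n by exact_mod_cast hn)).symm.nonneg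
    exact ENNReal.mul_lt_top ENNReal.coe_lt_top
      (ENNReal.rpow_lt_top_of_nonneg hp (ENNReal.mul_ne_top ENNReal.coe_ne_top (measure_ne_top m _)))
  refine lt_of_le_of_lt ?_ hfin
  -- The uniform bound passes to the limit by Fatou's lemma.
  calc ∫⁻ x, ∏ k, ‖V k x‖ₑ ^ ((1 : ℝ) / (n - 1))
      = ∫⁻ x, liminf (fun j => ∏ k,
        ‖((ρ j).normed volume ⋆[ContinuousLinearMap.lsmul ℝ ℝ] V k) x‖ₑ ^ ((1 : ℝ) / (n - 1)))
          atTop := by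
        refine lintegral_congr_ae ?_
        filter_upwards [hlim] with x hx
        refine (Tendsto.liminf_eq ?_).symm
        have hk : ∀ k, Tendsto (fun j =>
            ‖((ρ j).normed volume ⋆[ContinuousLinearMap.lsmul ℝ ℝ] V k) x‖ₑ ^
              ((1 : ℝ) / (n - 1))) atTop (𝓝 (‖V k x‖ₑ ^ ((1 : ℝ) / (n - 1)))) := fun k =>
          ((ENNReal.continuous_rpow_const).tendsto _).comp
            ((continuous_enorm.tendsto _).comp (hx k))
        have hne : ∀ k, ‖V k x‖ₑ ^ ((1 : ℝ) / (n - 1)) ≠ ⊤ := fun k =>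
          ENNReal.rpow_ne_top_of_nonneg hr enorm_ne_top
        exact ENNReal.tendsto_finsetProd_of_ne_top _ (fun k _ => hk k) fun k _ => hne k
    _ ≤ liminf (fun j => ∫⁻ x, ∏ k,
        ‖((ρ j).normed volume ⋆[ContinuousLinearMap.lsmul ℝ ℝ] V k) x‖ₑ ^ ((1 : ℝ) / (n - 1)))
          atTop := by
        refine lintegral_liminf_le fun j => ?_
        have hm : ∀ k, Measurable ((ρ j).normed volume ⋆[ContinuousLinearMap.lsmul ℝ ℝ] V k) :=
          fun k => ((ρ j).hasCompactSupport_normed.continuous_convolution_left _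
            (ρ j).continuous_normed (hV k).locallyIntegrable).measurable
        exact Finset.measurable_prod _ fun k _ => (hm k).enorm.pow_const _
    _ ≤ c * (c' * m univ) ^ Real.conjExponent n :=
        liminf_le_of_le (by isBoundedDefault) fun b hb => by
          obtain ⟨j, hj⟩ := hb.exists
          exact hj.trans (hbound j)

lemma IsTest.mono {F : Type*} [NormedAddCommGroup F] [NormedSpace ℝ F] {U V : Set (Vec n)}
    {φ : Vec n → F} (hφ : IsTest U φ) (h : U ⊆ V) : IsTest V φ :=
  ⟨hφ.1, hφ.2.1, hφ.2.2.trans h⟩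

lemma IsTest.continuous_pderiv {F : Type*} [NormedAddCommGroup F] [NormedSpace ℝ F]
    {U : Set (Vec n)} {φ : Vec n → F} (hφ : IsTest U φ) (i : Fin n) :
    Continuous (pderiv i φ) :=
  (hφ.1.continuous_fderiv (by simp)).clm_apply continuous_const

lemma IsTest.hasCompactSupport_pderiv {F : Type*} [NormedAddCommGroup F] [NormedSpace ℝ F]
    {U : Set (Vec n)} {φ : Vec n → F} (hφ : IsTest U φ) (i : Fin n) :
    HasCompactSupport (pderiv i φ) :=
  hφ.2.1.fderiv_apply ℝ _

lemma integrable_smul_of_hasCompactSupport {F : Type*} [NormedAddCommGroup F] [NormedSpace ℝ F]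
    {μ : Measure (Vec n)} {φ : Vec n → ℝ} (hφ : Continuous φ) (hφc : HasCompactSupport φ)
    {U : Vec n → F} (hU : Integrable U μ) : Integrable (fun x => φ x • U x) μ := by
  obtain ⟨C, hC⟩ := hφc.exists_bound_of_continuous hφ
  exact hU.bdd_smul C hφ.aestronglyMeasurable (ae_of_all _ hC)

lemma symTensor_gradient_eq_sum (a : Vec n) (φ : Vec n → ℝ) (x : Vec n) :
    symTensor a (gradient φ x) =
      ∑ k, pderiv k φ x • symTensorL.flip (EuclideanSpace.single k 1) a := by
  rw [symTensor_eq_sum]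
  simp [gradient_apply]

lemma integrable_symTensor_gradient {μ : Measure (Vec n)} {V : Set (Vec n)} {φ : Vec n → ℝ}
    (hφ : IsTest V φ) {U : Vec n → Vec n} (hU : Integrable U μ) :
    Integrable (fun x => symTensor (U x) (gradient φ x)) μ := by
  simp only [symTensor_gradient_eq_sum]
  exact integrable_finsetSum _ fun k _ =>
    integrable_smul_of_hasCompactSupport (hφ.continuous_pderiv k) (hφ.hasCompactSupport_pderiv k)
      ((symTensorL.flip (EuclideanSpace.single k 1)).integrable_comp hU)

/-- The basis `e i`, `e i ± e k` for `k ≠ i`. -/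
def starBasis (i : Fin n) (s : Fin n → Bool) : (Fin n → ℝ) ≃L[ℝ] Vec n :=
  (LinearMap.linearEquivOfInjective
    ({ toFun := fun y => WithLp.toLp 2 fun j =>
          if j = i then ∑ k, y k else (if s j then 1 else -1) * y j
       map_add' := fun a b => by
        ext j; by_cases hj : j = i <;> simp [hj, Finset.sum_add_distrib, mul_add]
       map_smul' := fun c a => by
        ext j; by_cases hj : j = i <;> simp [hj, Finset.mul_sum, mul_left_comm] } :
      (Fin n → ℝ) →ₗ[ℝ] Vec n)
    (by
      rw [← LinearMap.ker_eq_bot, LinearMap.ker_eq_bot']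
      intro y hy
      have hj : ∀ j, (if j = i then ∑ k, y k else (if s j then 1 else -1) * y j) = 0 := fun j =>
        congrArg (fun v : Vec n => v j) hy
      have h1 : ∀ j, j ≠ i → y j = 0 := fun j hji => by
        have h := hj j
        rw [if_neg hji] at h
        refine (mul_eq_zero.1 h).resolve_left ?_
        split_ifs <;> norm_num
      have h2 := hj i
      rw [if_pos rfl, Finset.sum_eq_single i (fun j _ hji => h1 j hji) (by simp)] at h2
      ext j
      rcases eq_or_ne j i with rfl | hji
      · exact h2
      · exact h1 j hji)
    (by simp)).toContinuousLinearEquiv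

lemma starBasis_single (i : Fin n) (s : Fin n → Bool) (k : Fin n) :
    starBasis i s (Pi.single k 1) = EuclideanSpace.single i 1 +
      if k = i then 0 else (if s k then (1 : ℝ) else -1) • EuclideanSpace.single k 1 := by
  ext j
  have h : starBasis i s (Pi.single k 1) j =
    if j = i then ∑ l, (Pi.single k (1 : ℝ) : Fin n → ℝ) l
      else (if s j then 1 else -1) * (Pi.single k (1 : ℝ) : Fin n → ℝ) j := rfl
  rw [h]
  by_cases hki : k = i
  · subst hki
    by_cases hj : j = k <;> simp [hj]
  · by_cases hj : j = i
    · subst hj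
      by_cases hs : s k <;> simp [hs, hki, Ne.symm hki]
    · by_cases hjk : j = k
      · subst hjk
        by_cases hs : s j <;> simp [hs, hj]
      · by_cases hs : s k <;> simp [hs, hj, hki, hjk]

/-- Choosing the sign of `e k` so that `± u i * u k ≥ 0` excludes cancellation in `u i ± u k`. A
geometric mean of components along such a basis then dominates the single coordinate `u i`. -/
lemma exists_abs_le_abs_inner_starBasis (i : Fin n) (u : Vec n) :
    ∃ s : Fin n → Bool, ∀ k, |u i| ≤ |⟪u, starBasis i s (Pi.single k 1)⟫| := by
  refine ⟨fun k => decide (0 ≤ u i * u k), fun k => ?_⟩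
  rw [starBasis_single]
  by_cases hk : k = i
  · simp [hk, EuclideanSpace.inner_single_right]
  · rw [if_neg hk, inner_add_right, inner_smul_right, EuclideanSpace.inner_single_right,
      EuclideanSpace.inner_single_right, ← sq_le_sq]
    simp only [decide_eq_true_eq, conj_trivial, one_mul]
    split_ifs with h
    · nlinarith [sq_nonneg (u k)]
    · nlinarith [sq_nonneg (u k)]

/-- A compactly supported integrable field whose symmetrized distributional gradient is a finite
measure is in `L^{n/(n-1)}`. -/
theorem memLp_of_symTensor_gradient_le (hn : 2 ≤ n) {U : Vec n → Vec n} (hU : Integrable U)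
    (hUc : HasCompactSupport U) {m : Measure (Vec n)} [IsFiniteMeasure m]
    (H : ∀ φ : Vec n → ℝ, IsTest univ φ →
      ‖∫ x, symTensor (U x) (gradient φ x)‖ₑ ≤ ∫⁻ x, ‖φ x‖ₑ ∂m) :
    MemLp U (ENNReal.ofReal (Real.conjExponent n)) volume := by
  have hn1 : (1 : ℝ) < n := by exact_mod_cast hn
  have hp := (Real.HolderConjugate.conjExponent hn1).symm
  have hr : (0 : ℝ) ≤ (1 : ℝ) / (n - 1) := div_nonneg zero_le_one (by linarith)
  have hdir : ∀ (ξ : Vec n) (φ : Vec n → ℝ), IsTest univ φ →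
      ‖∫ x, ⟪U x, ξ⟫ * fderiv ℝ φ x ξ‖ₑ ≤ ‖symTensor ξ ξ‖ₑ * ∫⁻ x, ‖φ x‖ₑ ∂m := by
    intro ξ φ hφ
    have e : ∫ x, ⟪U x, ξ⟫ * fderiv ℝ φ x ξ =
        ⟪symTensor ξ ξ, ∫ x, symTensor (U x) (gradient φ x)⟫ := by
      rw [← integral_inner (integrable_symTensor_gradient hφ hU)]
      refine integral_congr_ae (ae_of_all _ fun x => ?_)
      change _ = ⟪symTensor ξ ξ, symTensor (U x) (gradient φ x)⟫
      rw [real_inner_comm, inner_symTensor_self]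
      simp [gradient, InnerProductSpace.toDual_symm_apply]
    rw [e]
    refine le_trans ?_ (mul_le_mul_right (H φ hφ) _)
    rw [← ofReal_norm, ← ofReal_norm, ← ofReal_norm, ← ENNReal.ofReal_mul (norm_nonneg _)]
    exact ENNReal.ofReal_le_ofReal (norm_inner_le_norm _ _)
  have hfin : ∀ (i : Fin n) (s : Fin n → Bool),
      ∫⁻ x, ∏ k, ‖⟪U x, starBasis i s (Pi.single k 1)⟫‖ₑ ^ ((1 : ℝ) / (n - 1)) < ⊤ := by
    intro i s
    set C : ℝ≥0 := ∑ k, ‖symTensor (starBasis i s (Pi.single k 1))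
      (starBasis i s (Pi.single k 1))‖₊
    refine lintegral_prod_inner_lt_top hn (starBasis i s) hU hUc (m := C • m) fun k φ hφ => ?_
    refine (hdir _ φ hφ).trans ?_
    rw [lintegral_smul_measure]
    change _ ≤ (C : ℝ≥0∞) * _
    gcongr
    rw [enorm_eq_nnnorm]
    exact_mod_cast Finset.single_le_sum (f := fun k => ‖symTensor (starBasis i s (Pi.single k 1))
      (starBasis i s (Pi.single k 1))‖₊) (fun _ _ => zero_le) (Finset.mem_univ k)
  have hcoord : ∀ i, MemLp (fun x => U x i) (ENNReal.ofReal (Real.conjExponent n)) volume := by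
    intro i
    have hm : AEStronglyMeasurable (fun x => U x i) volume :=
      (EuclideanSpace.proj (𝕜 := ℝ) i).continuous.comp_aestronglyMeasurable hU.1
    refine ⟨hm, ?_⟩
    rw [eLpNorm_lt_top_iff_lintegral_rpow_enorm_lt_top
      (by simpa using hp.pos) ENNReal.ofReal_ne_top, ENNReal.toReal_ofReal hp.nonneg]
    calc ∫⁻ x, ‖U x i‖ₑ ^ Real.conjExponent n
        -- The good signs depend on `x`. Summing over all of the finitely many choices avoids a
        -- measurable selection.
        ≤ ∫⁻ x, ∑ s : Fin n → Bool,
          ∏ k, ‖⟪U x, starBasis i s (Pi.single k 1)⟫‖ₑ ^ ((1 : ℝ) / (n - 1)) := by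
          refine lintegral_mono fun x => ?_
          obtain ⟨s, hs⟩ := exists_abs_le_abs_inner_starBasis i (U x)
          refine le_trans ?_ (Finset.single_le_sum (fun _ _ => zero_le) (Finset.mem_univ s))
          calc ‖U x i‖ₑ ^ Real.conjExponent n
              = ∏ _k : Fin n, ‖U x i‖ₑ ^ ((1 : ℝ) / (n - 1)) := by
                -- There are `n` equal factors with exponent `1/(n-1)`, hence the exponent
                -- `n/(n-1)`.
                rw [Finset.prod_const, Finset.card_univ, Fintype.card_fin, ← ENNReal.rpow_natCast,
                  ← ENNReal.rpow_mul, Real.conjExponent]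
                congr 1
                ring
            _ ≤ _ := by
                gcongr with k
                rw [enorm_le_iff_norm_le, Real.norm_eq_abs, Real.norm_eq_abs]
                exact hs k
      _ = ∑ s : Fin n → Bool,
          ∫⁻ x, ∏ k, ‖⟪U x, starBasis i s (Pi.single k 1)⟫‖ₑ ^ ((1 : ℝ) / (n - 1)) := by
          refine lintegral_finsetSum' _ fun s _ => ?_
          exact Finset.aemeasurable_fun_prod _ fun k _ =>
            (hU.1.inner_const.enorm).pow_const _
      _ < ⊤ := ENNReal.sum_lt_top.2 fun s _ => hfin i s
  have hsum : U = fun x => ∑ i, U x i • EuclideanSpace.single i (1 : ℝ) := by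
    ext x i; simp [Pi.single_apply]
  rw [hsum]
  exact memLp_finsetSum _ fun i _ => (ContinuousLinearMap.toSpanSingleton ℝ
    (EuclideanSpace.single i (1 : ℝ) : Vec n)).comp_memLp' (hcoord i)

/-- Extend `u` by zero. The Green formula on `ℝⁿ` shows that the symmetrized distributional gradient
of the extension is `Eu` minus the boundary density `u ⊙ ν`, so it is dominated by the finite
measure `|Eu| + |u ⊙ ν| ℋ^{n-1}`. -/
theorem BD.memLp (hn : 2 ≤ n) {Ω : Set (Vec n)} (hΩ : IsOpen Ω) (hb : Bornology.IsBounded Ω)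
    (u : BD Ω) : MemLp u.toFun (ENNReal.ofReal (Real.conjExponent n)) (volume.restrict Ω) := by
  set N : Vec n → Sym n := fun x => symTensor (u.trace x) (outerNormal Ω x)
  have hN : IntegrableOn N (frontier Ω) (surf n) := u.trace_normal_integrable
  set μb : Measure (Vec n) := ((surf n).restrict (frontier Ω)).withDensity fun x => ‖N x‖ₑ
  have hμb : IsFiniteMeasure μb := isFiniteMeasure_withDensity hN.2.ne
  have hU : Integrable (Ω.indicator u.toFun) :=
    (integrable_indicator_iff hΩ.measurableSet).2 u.integrable
  have hUc : HasCompactSupport (Ω.indicator u.toFun) :=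
    HasCompactSupport.intro hb.isCompact_closure fun x hx =>
      indicator_of_notMem (fun h => hx (subset_closure h)) _
  rw [← memLp_indicator_iff_restrict hΩ.measurableSet]
  refine memLp_of_symTensor_gradient_le hn hU hUc (m := u.strain.variation + μb) fun φ hφ => ?_
  have e1 : ∫ x, symTensor (Ω.indicator u.toFun x) (gradient φ x) =
      ∫ x in Ω, symTensor (u.toFun x) (gradient φ x) := by
    rw [← integral_indicator hΩ.measurableSet]
    congr 1
    ext1 x
    by_cases hx : x ∈ Ω
    · simp [hx]
    · simp only [hx, not_false_eq_true, indicator_of_notMem]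
      rw [← symTensorL_apply, map_zero, zero_apply]
  have hg := u.green φ hφ
  rw [e1, eq_sub_of_add_eq' hg, lintegral_add_measure, add_comm (∫⁻ x, ‖φ x‖ₑ ∂_)]
  refine (enorm_sub_le).trans (add_le_add ?_ ?_)
  · rw [lintegral_withDensity_eq_lintegral_mul₀ hN.1.enorm
      hφ.1.continuous.measurable.enorm.aemeasurable]
    refine (enorm_integral_le_lintegral_enorm _).trans (lintegral_mono fun x => ?_)
    rw [enorm_smul, mul_comm]
    rfl
  · refine (VectorMeasure.enorm_integral_le_lintegral_enorm_transpose).trans_eq ?_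
    rw [VectorMeasure.variation_transpose_lsmul]
    rfl

/-- Hölder with the conjugate exponents `n` and `n/(n-1)`. Integrability is essential: a Bochner
integral that fails to exist is `0` by convention, and the work would not be additive. -/
lemma BD.integrable_inner (hn : 2 ≤ n) {Ω : Set (Vec n)} (hΩ : IsOpen Ω)
    (hb : Bornology.IsBounded Ω) (u : BD Ω) {f : Vec n → Vec n} (hf : MemLp f n volume) :
    IntegrableOn (fun x => ⟪f x, u.toFun x⟫) Ω := by
  have hn1 : (1 : ℝ) < n := by exact_mod_cast hn
  have h1 : MemLp f (ENNReal.ofReal n) (volume.restrict Ω) := by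
    rw [ENNReal.ofReal_natCast]; exact hf.restrict Ω
  have h2 := u.memLp hn hΩ hb
  have := (Real.HolderConjugate.conjExponent hn1).ennrealOfReal
  refine (h1.norm.integrable_mul h2.norm).mono (h1.1.inner h2.1) (ae_of_all _ fun x => ?_)
  simpa using abs_real_inner_le_norm (f x) (u.toFun x)

/-! ### Construction of competitors -/

lemma IsTest.eq_zero_of_notMem {F : Type*} [NormedAddCommGroup F] [NormedSpace ℝ F]
    {U : Set (Vec n)} {φ : Vec n → F} (hφ : IsTest U φ) {x : Vec n} (hx : x ∉ U) : φ x = 0 :=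
  image_eq_zero_of_notMem_tsupport fun h => hx (hφ.2.2 h)

lemma IsTest.pderiv_eq_zero_of_notMem {F : Type*} [NormedAddCommGroup F] [NormedSpace ℝ F]
    {U : Set (Vec n)} {φ : Vec n → F} (hφ : IsTest U φ) (i : Fin n) {x : Vec n} (hx : x ∉ U) :
    pderiv i φ x = 0 := by
  have h : fderiv ℝ φ x = 0 :=
    image_eq_zero_of_notMem_tsupport fun h => hx (hφ.2.2 (tsupport_fderiv_subset ℝ h))
  rw [pderiv, h, zero_apply]

lemma integrable_of_test (p : VectorMeasure (Vec n) (Sym n)) {U : Set (Vec n)} {φ : Vec n → ℝ}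
    (hφ : IsTest U φ) : p.Integrable φ :=
  have h : ∀ μ : Measure (Vec n), IsFiniteMeasure μ → Integrable φ μ := fun _ _ =>
    hφ.1.continuous.integrable_of_hasCompactSupport hφ.2.1
  h _ (isFiniteMeasure_variation p)

namespace BD

variable {Ω : Set (Vec n)}

/-- The element `u + c v` of `BD(Ω)`. -/
def addSMul (u : BD Ω) (c : ℝ) (v : BD Ω) : BD Ω :=
  have hN : ∀ x, symTensor (u.trace x + c • v.trace x) (outerNormal Ω x) =
      symTensor (u.trace x) (outerNormal Ω x) + c • symTensor (v.trace x) (outerNormal Ω x) :=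
    fun x => by simp only [← symTensorL_apply, map_add, map_smul, add_apply, smul_apply]
  have hint : ∀ φ : Vec n → ℝ, IsTest univ φ →
      VectorMeasure.integral (u.strain + c • v.strain) φ (ContinuousLinearMap.lsmul ℝ ℝ) =
        VectorMeasure.integral u.strain φ (ContinuousLinearMap.lsmul ℝ ℝ) +
          c • VectorMeasure.integral v.strain φ (ContinuousLinearMap.lsmul ℝ ℝ) := fun φ hφ => by
    rw [VectorMeasure.integral_add_vectorMeasure (integrable_of_test _ hφ)
      (integrable_of_test _ hφ), VectorMeasure.integral_smul_vectorMeasure]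
  have hvol : ∀ φ : Vec n → ℝ, IsTest univ φ →
      ∫ x in Ω, symTensor (u.toFun x + c • v.toFun x) (gradient φ x) =
        (∫ x in Ω, symTensor (u.toFun x) (gradient φ x)) +
          c • ∫ x in Ω, symTensor (v.toFun x) (gradient φ x) := fun φ hφ => by
    rw [← integral_smul, ← integral_add (integrable_symTensor_gradient hφ u.integrable)
      ((integrable_symTensor_gradient hφ v.integrable).fun_smul c)]
    simp only [← symTensorL_apply, map_add, map_smul, add_apply, smul_apply]
  { toFun := fun x => u.toFun x + c • v.toFun x
    strain := u.strain + c • v.strain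
    trace := fun x => u.trace x + c • v.trace x
    integrable := u.integrable.add (v.integrable.smul c)
    strain_concentrated := fun A hA => by
      simp [u.strain_concentrated A hA, v.strain_concentrated A hA]
    strain_spec := fun φ hφ => by
      rw [hint φ (hφ.mono (subset_univ _)), hvol φ (hφ.mono (subset_univ _)),
        u.strain_spec φ hφ, v.strain_spec φ hφ, smul_neg, neg_add]
    trace_integrable := u.trace_integrable.add (v.trace_integrable.smul c)
    trace_normal_integrable := by
      simp only [hN]
      exact u.trace_normal_integrable.add (v.trace_normal_integrable.smul c)
    green := fun φ hφ => by
      have h1 := integrable_smul_of_hasCompactSupport hφ.1.continuous hφ.2.1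
        u.trace_normal_integrable
      have h2 := integrable_smul_of_hasCompactSupport hφ.1.continuous hφ.2.1
        v.trace_normal_integrable
      rw [hint φ hφ, hvol φ hφ, add_add_add_comm, ← smul_add, u.green φ hφ, v.green φ hφ,
        ← integral_smul, ← integral_add h1 (h2.fun_smul c)]
      refine integral_congr_ae (ae_of_all _ fun x => ?_)
      simp only [hN, smul_add, smul_comm (φ x) c] }

end BD

lemma H1.integrableOn {F : Type*} [NormedAddCommGroup F] [NormedSpace ℝ F] {Ω : Set (Vec n)}
    (hb : Bornology.IsBounded Ω) (ψ : H1 Ω Ω F) : IntegrableOn ψ.toFun Ω := by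
  have : IsFiniteMeasure (volume.restrict Ω) := ⟨by simpa using hb.measure_lt_top⟩
  exact ψ.memLp.integrable one_le_two

lemma H1.integrableOn_grad {F : Type*} [NormedAddCommGroup F] [NormedSpace ℝ F] {Ω : Set (Vec n)}
    (hb : Bornology.IsBounded Ω) (ψ : H1 Ω Ω F) (i : Fin n) : IntegrableOn (ψ.grad i) Ω := by
  have : IsFiniteMeasure (volume.restrict Ω) := ⟨by simpa using hb.measure_lt_top⟩
  exact (ψ.grad_memLp i).integrable one_le_two

/-- The symmetrized gradient of an element of `H¹`. -/
def H1.sgrad {Ω : Set (Vec n)} (ψ : H1 Ω Ω (Vec n)) (x : Vec n) : Sym n :=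
  symGrad fun i => ψ.grad i x

lemma H1.sgrad_memLp {Ω : Set (Vec n)} (ψ : H1 Ω Ω (Vec n)) :
    MemLp ψ.sgrad 2 (volume.restrict Ω) := by
  have h : MemLp (fun x i => ψ.grad i x) 2 (volume.restrict Ω) := memLp_pi_iff.2 ψ.grad_memLp
  exact symGradL.comp_memLp' h

lemma H1.sgrad_integrable {Ω : Set (Vec n)} (hb : Bornology.IsBounded Ω)
    (ψ : H1 Ω Ω (Vec n)) : IntegrableOn ψ.sgrad Ω := by
  have : IsFiniteMeasure (volume.restrict Ω) := ⟨by simpa using hb.measure_lt_top⟩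
  exact ψ.sgrad_memLp.integrable one_le_two

/-- Apply the linear maps `v ↦ v ⊙ e k` to the Green formulas for the partial derivatives and sum
over `k`. -/
lemma H1.green_sgrad {Ω : Set (Vec n)} (hb : Bornology.IsBounded Ω) (ψ : H1 Ω Ω (Vec n))
    {φ : Vec n → ℝ} (hφ : IsTest univ φ) :
    (∫ x in Ω, φ x • ψ.sgrad x) + ∫ x in Ω, symTensor (ψ.toFun x) (gradient φ x) =
      ∫ x in frontier Ω, φ x • symTensor (ψ.trace x) (outerNormal Ω x) ∂(surf n) := by
  have hs := integrable_smul_of_hasCompactSupport hφ.1.continuous hφ.2.1 (ψ.sgrad_integrable hb)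
  have ht := integrable_symTensor_gradient hφ (ψ.integrableOn hb)
  set S : Fin n → Vec n →L[ℝ] Sym n := fun k => symTensorL.flip (EuclideanSpace.single k 1)
  have hvol : ∀ k, Integrable (fun x => φ x • ψ.grad k x + pderiv k φ x • ψ.toFun x)
      (volume.restrict Ω) := fun k =>
    (integrable_smul_of_hasCompactSupport hφ.1.continuous hφ.2.1
      (ψ.integrableOn_grad hb k)).add
    (integrable_smul_of_hasCompactSupport (hφ.continuous_pderiv k) (hφ.hasCompactSupport_pderiv k)
      (ψ.integrableOn hb))
  have hbd : ∀ k, Integrable (fun x => (φ x * outerNormal Ω x k) • ψ.trace x)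
      ((surf n).restrict (frontier Ω)) := fun k => by
    simp only [mul_smul]
    exact integrable_smul_of_hasCompactSupport hφ.1.continuous hφ.2.1
      (ψ.trace_normal_integrable k)
  rw [← integral_add hs ht]
  calc ∫ x in Ω, (φ x • ψ.sgrad x + symTensor (ψ.toFun x) (gradient φ x))
      = ∫ x in Ω, ∑ k, S k (φ x • ψ.grad k x + pderiv k φ x • ψ.toFun x) := by
        refine integral_congr_ae (ae_of_all _ fun x => ?_)
        change φ x • symGrad (fun i => ψ.grad i x) + _ = _
        simp only [map_add, map_smul, Finset.sum_add_distrib, symTensor_gradient_eq_sum, S,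
          symGrad_eq_sum, Finset.smul_sum]
        rfl
    _ = ∑ k, S k (∫ x in Ω, (φ x • ψ.grad k x + pderiv k φ x • ψ.toFun x)) := by
        rw [integral_finsetSum _ fun k _ => (S k).integrable_comp (hvol k)]
        exact Finset.sum_congr rfl fun k _ => (S k).integral_comp_comm (hvol k)
    _ = ∑ k, S k (∫ x in frontier Ω, (φ x * outerNormal Ω x k) • ψ.trace x ∂(surf n)) :=
        Finset.sum_congr rfl fun k _ => by rw [ψ.green φ hφ k]
    _ = ∫ x in frontier Ω, ∑ k, S k ((φ x * outerNormal Ω x k) • ψ.trace x) ∂(surf n) := by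
        rw [integral_finsetSum _ fun k _ => (S k).integrable_comp (hbd k)]
        exact Finset.sum_congr rfl fun k _ => ((S k).integral_comp_comm (hbd k)).symm
    _ = _ := by
        refine integral_congr_ae (ae_of_all _ fun x => ?_)
        change _ = φ x • symTensor _ _
        rw [symTensor_eq_sum, Finset.smul_sum]
        refine Finset.sum_congr rfl fun k _ => ?_
        rw [map_smul, mul_smul]
        rfl

/-- An element of `H¹(Ω)` as an element of `BD(Ω)`. -/
def H1.toBD {Ω : Set (Vec n)} (hΩ : IsOpen Ω) (hb : Bornology.IsBounded Ω)
    (ψ : H1 Ω Ω (Vec n)) : BD Ω :=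
  have hE : ∀ φ : Vec n → ℝ, IsTest univ φ →
      VectorMeasure.integral ((volume.restrict Ω).withDensityᵥ ψ.sgrad) φ
        (ContinuousLinearMap.lsmul ℝ ℝ) = ∫ x in Ω, φ x • ψ.sgrad x := fun φ hφ => by
    obtain ⟨C, hC⟩ := hφ.2.1.exists_bound_of_continuous hφ.1.continuous
    exact integral_withDensityᵥ (ψ.sgrad_integrable hb) hφ.1.continuous.stronglyMeasurable hC
  { toFun := ψ.toFun
    strain := (volume.restrict Ω).withDensityᵥ ψ.sgrad
    trace := ψ.trace
    integrable := ψ.integrableOn hb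
    strain_concentrated := fun A hA => by
      by_cases hm : MeasurableSet A
      · rw [withDensityᵥ_apply (ψ.sgrad_integrable hb) hm, Measure.restrict_restrict hm,
          disjoint_iff_inter_eq_empty.1 hA, Measure.restrict_empty, integral_zero_measure]
      · exact VectorMeasure.not_measurable _ hm
    strain_spec := fun φ hφ => by
      have h := ψ.green_sgrad hb (hφ.mono (subset_univ _))
      have h0 : ∫ x in frontier Ω, φ x • symTensor (ψ.trace x) (outerNormal Ω x) ∂(surf n) = 0 := by
        refine setIntegral_eq_zero_of_forall_eq_zero fun x hx => ?_
        rw [hφ.eq_zero_of_notMem (hΩ.frontier_eq ▸ hx).2, zero_smul]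
      rw [hE φ (hφ.mono (subset_univ _))]
      exact eq_neg_of_add_eq_zero_left (h.trans h0)
    trace_integrable := ψ.trace_integrable
    trace_normal_integrable := by
      have h : (fun x => symTensor (ψ.trace x) (outerNormal Ω x)) = fun x => ∑ k,
          symTensorL.flip (EuclideanSpace.single k 1) (outerNormal Ω x k • ψ.trace x) := by
        ext1 x
        rw [symTensor_eq_sum]
        simp
      rw [h]
      exact integrable_finsetSum _ fun k _ =>
        ContinuousLinearMap.integrable_comp _ (ψ.trace_normal_integrable k)
    green := fun φ hφ => by rw [hE φ hφ]; exact ψ.green_sgrad hb hφ }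

/-- A test function as an element of `H¹(Ω)`. -/
def IsTest.toH1 {F : Type*} [NormedAddCommGroup F] [NormedSpace ℝ F] {Ω : Set (Vec n)}
    {φ : Vec n → F} (hφ : IsTest Ω φ) : H1 Ω Ω F :=
  have key : ∀ χ : Vec n → ℝ, IsTest univ χ → ∀ i,
      (∫ x in Ω, pderiv i χ x • φ x = -∫ x in Ω, χ x • pderiv i φ x) ∧
      Integrable (fun x => χ x • pderiv i φ x) ∧ Integrable (fun x => pderiv i χ x • φ x) :=
    fun χ hχ i => by
    have hφi : Integrable φ := hφ.1.continuous.integrable_of_hasCompactSupport hφ.2.1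
    have hdφ : Integrable (pderiv i φ) :=
      (hφ.continuous_pderiv i).integrable_of_hasCompactSupport (hφ.hasCompactSupport_pderiv i)
    have h1 := integrable_smul_of_hasCompactSupport hχ.1.continuous hχ.2.1 hdφ
    have h2 := integrable_smul_of_hasCompactSupport (hχ.continuous_pderiv i)
      (hχ.hasCompactSupport_pderiv i) hφi
    have h3 := integrable_smul_of_hasCompactSupport hχ.1.continuous hχ.2.1 hφi
    refine ⟨?_, h1, h2⟩
    rw [setIntegral_eq_integral_of_forall_compl_eq_zero fun x hx => by
        rw [hφ.eq_zero_of_notMem hx, smul_zero],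
      setIntegral_eq_integral_of_forall_compl_eq_zero fun x hx => by
        rw [hφ.pderiv_eq_zero_of_notMem i hx, smul_zero]]
    have h := integral_smul_fderiv_eq_neg_fderiv_smul_of_integrable h2 h1 h3
      (fun x _ => (hχ.1.differentiable (by simp)) x) (fun x _ => (hφ.1.differentiable (by simp)) x)
    exact (neg_eq_iff_eq_neg.2 h).symm
  { toFun := φ
    grad := fun i => pderiv i φ
    -- The support of `φ` is inside `Ω`, so integration by parts on `ℝⁿ` leaves no boundary term and
    -- the zero trace satisfies the Green formula.
    trace := 0
    memLp := (hφ.1.continuous.memLp_of_hasCompactSupport hφ.2.1).restrict Ω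
    grad_memLp := fun i => ((hφ.continuous_pderiv i).memLp_of_hasCompactSupport
      (hφ.hasCompactSupport_pderiv i)).restrict Ω
    grad_spec := fun χ hχ i => (key χ (hχ.mono (subset_univ _)) i).1
    trace_integrable := integrableOn_zero
    trace_normal_integrable := fun i => by simp
    green := fun χ hχ i => by
      obtain ⟨h, h1, h2⟩ := key χ hχ i
      rw [integral_add h1.integrableOn h2.integrableOn, h]
      simp }

/-! ### Consequences of stability -/

lemma sym_inner_smul_left (c : ℝ) (a b : Sym n) : ⟪c • a, b⟫ = c * ⟪a, b⟫ :=
  real_inner_smul_left a b c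

lemma sym_inner_smul_right (c : ℝ) (a b : Sym n) : ⟪a, c • b⟫ = c * ⟪a, b⟫ :=
  real_inner_smul_right a b c

lemma isTest_zero {F : Type*} [NormedAddCommGroup F] [NormedSpace ℝ F] (U : Set (Vec n)) :
    IsTest U (0 : Vec n → F) :=
  ⟨contDiff_const, HasCompactSupport.zero, by simp [tsupport]⟩

/-- The exceptional set is empty, and the zero function is admissible for its capacity with `N = ∅`.
-/
lemma isQuasicontRep_zero (Ω : Set (Vec n)) : IsQuasicontRep Ω 0 0 := by
  refine ⟨EventuallyEq.rfl, fun ε hε => ⟨∅, empty_subset _, ?_, continuousOn_const⟩⟩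
  refine lt_of_le_of_lt ?_ hε
  have h0 : IsW012 Ω 0 0 := by
    refine ⟨MemLp.zero, fun i => MemLp.zero, fun _ => 0, fun _ => isTest_zero Ω, ?_, fun i => ?_⟩
    · simp
    · have : pderiv i (0 : Vec n → ℝ) = 0 := by
        ext x
        simp [pderiv]
      simp [this]
  refine (iInf₂_le (0 : Vec n → ℝ) (0 : Fin n → Vec n → ℝ)).trans
    ((iInf₂_le h0 ⟨∅, isOpen_empty, empty_subset _, by simp⟩).trans ?_)
  simp

lemma le_zero_of_forall_quadratic {a b : ℝ} (h : ∀ ε > 0, ε * a ≤ ε ^ 2 * b) : a ≤ 0 := by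
  refine le_of_forall_pos_le_add fun δ hδ => ?_
  have hb : 0 < |b| + 1 := by positivity
  -- After division by `ε`, this value makes `ε * b` at most `δ`; adding `1` to `|b|` covers `b =
  -- 0`.
  have h1 := h (δ / (|b| + 1)) (by positivity)
  have h2 : a ≤ δ / (|b| + 1) * b := by
    rw [sq, mul_assoc] at h1
    exact le_of_mul_le_mul_left h1 (by positivity)
  have h3 : δ / (|b| + 1) * b ≤ δ := by
    rw [div_mul_eq_mul_div, div_le_iff₀ hb]
    nlinarith [le_abs_self b]
  linarith

lemma MemLp.integrable_inner_of_two {X E : Type*} [MeasurableSpace X] [NormedAddCommGroup E]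
    [InnerProductSpace ℝ E] {μ : Measure X} {f g : X → E} (hf : MemLp f 2 μ) (hg : MemLp g 2 μ) :
    Integrable (fun x => ⟪f x, g x⟫) μ := by
  refine (hf.norm.integrable_mul hg.norm).mono (hf.1.inner hg.1) (ae_of_all _ fun x => ?_)
  simpa using abs_real_inner_le_norm (f x) (g x)

/-! ### Energies and work along affine perturbations. -/

namespace Model

variable {M : Model n}

lemma plastic_zero : M.plastic 0 = 0 := by
  simp [plastic]

/-- Zero damage makes both constraints on `p` vacuous, since `{0 < α}` and `{α = 1}` are empty, and
the integrand vanishes because `ℂ₁(0) = 0`. Thus every plastic strain has finite hardening energy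
with this damage. -/
lemma hardening_zero (hM : M.Standing) (p : VectorMeasure (Vec n) (Sym n)) :
    M.hardening (isTest_zero M.Ω).toH1 p = 0 := by
  have h0 : M.C1 0 = 0 := (hM.C1_eq_zero 0 (by simp)).2 rfl
  rw [hardening, if_pos]
  · simp [IsTest.toH1, h0]
  · exact ⟨⟨0, isQuasicontRep_zero _, by simp [IsTest.toH1]⟩, ae_of_all _ fun x h => by
      simp [IsTest.toH1] at h⟩

lemma elastic_add (hM : M.Standing) {e η : Vec n → Sym n} (he : MemLp e 2 (volume.restrict M.Ω))
    (hη : MemLp η 2 (volume.restrict M.Ω)) (c : ℝ) :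
    M.elastic (fun x => e x + c • η x) =
      M.elastic e + c * (∫ x in M.Ω, ⟪M.C (e x), η x⟫) + c ^ 2 * M.elastic η := by
  have h1 := MemLp.integrable_inner_of_two (M.C.comp_memLp' he) he
  have h2 := MemLp.integrable_inner_of_two (M.C.comp_memLp' he) hη
  have h3 := MemLp.integrable_inner_of_two (M.C.comp_memLp' hη) hη
  simp only [elastic]
  have e1 : ∀ x, ⟪M.C (e x + c • η x), e x + c • η x⟫ = ⟪M.C (e x), e x⟫ +
      (2 * c) * ⟪M.C (e x), η x⟫ + c ^ 2 * ⟪M.C (η x), η x⟫ := fun x => by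
    simp only [map_add, map_smul, inner_add_left, inner_add_right, sym_inner_smul_left,
      sym_inner_smul_right]
    rw [hM.C_symm (η x) (e x), real_inner_comm (M.C (e x)) (η x)]
    ring
  simp only [e1]
  have h4 := integral_add (h1.add (h2.const_mul (2 * c))) (h3.const_mul (c ^ 2))
  have h5 := integral_add h1 (h2.const_mul (2 * c))
  simp only [Function.comp_apply, Pi.add_apply] at h4 h5
  rw [h4, h5, integral_const_mul, integral_const_mul]
  ring

lemma measurableSet_dirichlet (hM : M.Standing) : MeasurableSet M.ΓD := by
  obtain ⟨O, hO, h⟩ := hM.dirichlet_relOpen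
  rw [h]
  exact hO.measurableSet.inter isClosed_frontier.measurableSet

lemma neumann_subset (hM : M.Standing) : M.ΓN ⊆ frontier M.Ω := by
  obtain ⟨O, -, h⟩ := hM.neumann_relOpen
  rw [h]
  exact inter_subset_right

lemma dirichlet_subset (hM : M.Standing) : M.ΓD ⊆ frontier M.Ω := by
  obtain ⟨O, -, h⟩ := hM.dirichlet_relOpen
  rw [h]
  exact inter_subset_right

lemma disjoint_dirichlet (hM : M.Standing) : Disjoint M.Ω M.ΓD :=
  disjoint_left.2 fun _ hx hD => (hM.isOpen.frontier_eq ▸ dirichlet_subset hM hD).2 hx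

lemma integrable_inner_traction {g τ : Vec n → Vec n} (hM : M.Standing)
    (hg : MemLp g ⊤ ((surf n).restrict M.ΓN)) (hτ : IntegrableOn τ (frontier M.Ω) (surf n)) :
    Integrable (fun x => ⟪g x, τ x⟫) ((surf n).restrict M.ΓN) := by
  have h1 := memLp_one_iff_integrable.2 (hτ.mono_set (neumann_subset hM))
  refine (hg.norm.integrable_mul h1.norm).mono (hg.1.inner h1.1) (ae_of_all _ fun x => ?_)
  simpa using abs_real_inner_le_norm (g x) (τ x)

lemma work_addSMul (hn : 2 ≤ n) (hM : M.Standing) {f g : Vec n → Vec n} (hf : MemLp f n volume)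
    (hg : MemLp g ⊤ ((surf n).restrict M.ΓN)) (u v : BD M.Ω) (c : ℝ) :
    M.work f g (u.addSMul c v).toFun (u.addSMul c v).trace =
      M.work f g u.toFun u.trace + c * M.work f g v.toFun v.trace := by
  have h1 := u.integrable_inner hn hM.isOpen hM.bounded hf
  have h2 := v.integrable_inner hn hM.isOpen hM.bounded hf
  have h3 := integrable_inner_traction hM hg u.trace_integrable
  have h4 := integrable_inner_traction hM hg v.trace_integrable
  simp only [work, BD.addSMul, inner_add_right, inner_smul_right]
  rw [integral_add h1 (h2.const_mul c), integral_add h3 (h4.const_mul c), integral_const_mul,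
    integral_const_mul]
  ring

end Model

/-! ### Variations of the displacement: equilibrium and traction. -/

namespace Loading

variable {M : Model n} {L : Loading M} {t : ℝ} {s : State M}

lemma energy_eq (L : Loading M) (t : ℝ) {s : State M} (h : M.hardening s.α s.p ≠ ⊤) :
    L.energy t s = ((M.elastic s.e + M.damage s.α + M.gradEnergy s.α
      - M.work (L.f t) (L.g t) s.u.toFun s.u.trace + (M.hardening s.α s.p).toReal : ℝ) : EReal) := by
  rw [energy, ← EReal.coe_ennreal_toReal h, EReal.coe_add]

/-- The zero damage is an admissible competitor because `0 ≤ 0 ≤ α`. With `u`, `e`, `p` unchanged it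
costs no dissipation and has finite energy, which stability transfers to the state itself. -/
lemma Stable.hardening_ne_top (hs : L.Stable t s) (hM : M.Standing)
    (hα : ∀ᵐ x ∂(volume.restrict M.Ω), 0 ≤ s.α.toFun x) : M.hardening s.α s.p ≠ ⊤ := by
  intro htop
  have h := hs.2 ⟨(isTest_zero M.Ω).toH1, s.u, s.e, s.p⟩
    (by filter_upwards [hα] with x hx using ⟨le_rfl, hx⟩) hs.1
  have h0 : M.hardening (isTest_zero M.Ω).toH1 s.p = 0 := Model.hardening_zero hM s.p
  rw [energy_eq L t (s := ⟨(isTest_zero M.Ω).toH1, s.u, s.e, s.p⟩) (by simp [h0]), sub_self,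
    Model.plastic_zero, energy, htop] at h
  simp only [EReal.coe_ennreal_top, EReal.coe_add_top, EReal.coe_ennreal_zero, add_zero,
    top_le_iff] at h
  exact EReal.coe_ne_top _ h

/-- Keeping the damage cancels `D` and the gradient term. With both hardening energies finite, the
stability inequality in `EReal` becomes one between real numbers. -/
lemma Stable.le_competitor (hs : L.Stable t s) (hM : M.Standing)
    (hα : ∀ᵐ x ∂(volume.restrict M.Ω), 0 ≤ s.α.toFun x) {u : BD M.Ω} {e : Vec n → Sym n}
    {p : VectorMeasure (Vec n) (Sym n)} (hadm : M.Admissible (L.w t) u e p)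
    (hhard : M.hardening s.α p ≠ ⊤) {d : ℝ} (hd : 0 ≤ d)
    (hplast : M.plastic (p - s.p) ≤ ENNReal.ofReal d) :
    M.elastic s.e - M.work (L.f t) (L.g t) s.u.toFun s.u.trace + (M.hardening s.α s.p).toReal ≤
      M.elastic e - M.work (L.f t) (L.g t) u.toFun u.trace + (M.hardening s.α p).toReal + d := by
  have h := hs.2 ⟨s.α, u, e, p⟩ (by filter_upwards [hα] with x hx using ⟨hx, le_rfl⟩) hadm
  rw [energy_eq L t (hs.hardening_ne_top hM hα), energy_eq L t (s := ⟨s.α, u, e, p⟩) hhard] at h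
  have h2 := h.trans (add_le_add_right (EReal.coe_ennreal_le_coe_ennreal_iff.2 hplast) _)
  rw [EReal.coe_ennreal_ofReal, max_eq_left hd, ← EReal.coe_add, EReal.coe_le_coe_iff] at h2
  simp only at h2
  linarith

/-- The virtual work identity: `∫ σ : Eψ = ⟨ℒ(t), ψ⟩` if the trace of `ψ` vanishes on `ΓD`. -/
theorem Stable.virtual_work (hn : 2 ≤ n) (hs : L.Stable t s) (hM : M.Standing)
    (hf : MemLp (L.f t) n volume) (hg : MemLp (L.g t) ⊤ ((surf n).restrict M.ΓN))
    (hα : ∀ᵐ x ∂(volume.restrict M.Ω), 0 ≤ s.α.toFun x) (ψ : H1 M.Ω M.Ω (Vec n))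
    (hψ : ∀ᵐ x ∂((surf n).restrict M.ΓD), ψ.trace x = 0) :
    ∫ x in M.Ω, ⟪M.C (s.e x), ψ.sgrad x⟫ = M.work (L.f t) (L.g t) ψ.toFun ψ.trace := by
  set v := ψ.toBD hM.isOpen hM.bounded
  -- The added strain is absorbed entirely by the elastic part, and the zero trace of `ψ` on `ΓD`
  -- leaves the boundary part of `p` unchanged.
  have hadm : ∀ c : ℝ, M.Admissible (L.w t) (s.u.addSMul c v)
      (fun x => s.e x + c • ψ.sgrad x) s.p := fun c =>
    { e_memLp := hs.1.e_memLp.add (ψ.sgrad_memLp.const_smul c)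
      p_concentrated := hs.1.p_concentrated
      strain_eq := fun A hA hAΩ => by
        have : IsFiniteMeasure (volume.restrict M.Ω) := ⟨by simpa using hM.bounded.measure_lt_top⟩
        have h1 : IntegrableOn s.e A := (hs.1.e_memLp.integrable one_le_two).mono_measure
          (Measure.restrict_mono hAΩ le_rfl)
        have h2 : IntegrableOn ψ.sgrad A := (ψ.sgrad_integrable hM.bounded).mono_set hAΩ
        have h3 : (s.u.addSMul c v).strain A = s.u.strain A + c • ∫ x in A, ψ.sgrad x := by
          change s.u.strain A + c • (volume.restrict M.Ω).withDensityᵥ ψ.sgrad A = _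
          rw [withDensityᵥ_apply (ψ.sgrad_integrable hM.bounded) hA, Measure.restrict_restrict hA,
            inter_eq_left.2 hAΩ]
        rw [h3, hs.1.strain_eq A hA hAΩ, integral_add h1 (h2.fun_smul c), integral_smul]
        abel
      boundary_eq := fun A hA hAD => by
        rw [hs.1.boundary_eq A hA hAD]
        refine setIntegral_congr_ae hA ?_
        filter_upwards [(ae_restrict_iff' (Model.measurableSet_dirichlet hM)).1 hψ] with x hx hxA
        change _ = symTensor ((L.w t).trace x - (s.u.trace x + c • ψ.trace x)) _
        rw [hx (hAD hxA), smul_zero, add_zero] }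
  have key : ∀ c : ℝ, c * (M.work (L.f t) (L.g t) ψ.toFun ψ.trace -
      ∫ x in M.Ω, ⟪M.C (s.e x), ψ.sgrad x⟫) ≤ c ^ 2 * M.elastic ψ.sgrad := fun c => by
    have h := hs.le_competitor hM hα (hadm c) (hs.hardening_ne_top hM hα) le_rfl
      (by rw [sub_self, Model.plastic_zero]; exact zero_le)
    rw [Model.elastic_add hM hs.1.e_memLp ψ.sgrad_memLp, Model.work_addSMul hn hM hf hg] at h
    change _ ≤ _ - (_ + c * M.work (L.f t) (L.g t) ψ.toFun ψ.trace) + _ + _ at h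
    linarith
  -- The variation is two-sided because it dissipates nothing: `ε` and `-ε` give opposite
  -- inequalities for the linear coefficient.
  have h1 := le_zero_of_forall_quadratic fun ε _ => key ε
  have h2 : -(M.work (L.f t) (L.g t) ψ.toFun ψ.trace -
      ∫ x in M.Ω, ⟪M.C (s.e x), ψ.sgrad x⟫) ≤ 0 :=
    le_zero_of_forall_quadratic (b := M.elastic ψ.sgrad) fun ε _ => by
      have := key (-ε)
      rw [neg_sq] at this
      linarith
  linarith

theorem Stable.hasWeakDiv (hn : 2 ≤ n) (hs : L.Stable t s) (hM : M.Standing)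
    (hf : MemLp (L.f t) n volume) (hg : MemLp (L.g t) ⊤ ((surf n).restrict M.ΓN))
    (hα : ∀ᵐ x ∂(volume.restrict M.Ω), 0 ≤ s.α.toFun x) :
    HasWeakDiv M.Ω (fun x => M.C (s.e x)) (-L.f t) := by
  intro φ hφ
  have h := hs.virtual_work hn hM hf hg hα hφ.toH1 (ae_of_all _ fun _ => rfl)
  have h2 : M.work (L.f t) (L.g t) hφ.toH1.toFun hφ.toH1.trace = ∫ x in M.Ω, ⟪L.f t x, φ x⟫ := by
    simp [Model.work, IsTest.toH1]
  rw [h2] at h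
  simp only [Pi.neg_apply, inner_neg_left, integral_neg, neg_neg]
  exact h

/-- Since `div σ = -f`, the volume term of `[σν]` cancels the work of `f` in the virtual work
identity, and only the work of `g` remains. -/
theorem Stable.hasTraction (hn : 2 ≤ n) (hs : L.Stable t s) (hM : M.Standing)
    (hf : MemLp (L.f t) n volume) (hg : MemLp (L.g t) ⊤ ((surf n).restrict M.ΓN))
    (hα : ∀ᵐ x ∂(volume.restrict M.Ω), 0 ≤ s.α.toFun x) :
    HasTraction M.Ω M.ΓD M.ΓN (fun x => M.C (s.e x)) (-L.f t) (L.g t) := by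
  intro ψ hψ
  have h := hs.virtual_work hn hM hf hg hα ψ hψ
  rw [Model.work] at h
  change _ + ∫ x in M.Ω, ⟪M.C (s.e x), ψ.sgrad x⟫ = _
  rw [h]
  simp only [Pi.neg_apply, inner_neg_left, integral_neg]
  ring

end Loading

/-! ### Perturbations of the plastic strain -/

lemma integrable_indicator_const {E : Type*} [NormedAddCommGroup E] {A : Set (Vec n)}
    (hA : MeasurableSet A) (hfin : volume A ≠ ⊤) (w : E) :
    Integrable (A.indicator fun _ => w) (volume : Measure (Vec n)) :=
  (integrable_indicator_iff hA).2 (integrableOn_const hfin)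

namespace Model

variable {M : Model n}

/-- The measure has constant direction on `A`, so its polar factor is the normalized `ξ` and its
variation is `|εξ|` times Lebesgue measure on `A`. Positive homogeneity of `H` then removes the
normalization. -/
lemma plastic_withDensityᵥ_indicator_le {A : Set (Vec n)} (hA : MeasurableSet A)
    (hfin : volume A ≠ ⊤) {ξ : Sym n} {c : ℝ} (hc : 0 ≤ c) (hK : ∀ σ ∈ M.K, ⟪σ, ξ⟫ ≤ c) {ε : ℝ}
    (hε : 0 < ε) :
    M.plastic (volume.withDensityᵥ (A.indicator fun _ => ε • ξ)) ≤
      ENNReal.ofReal (ε * c * volume.real A) := by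
  set w : Sym n := ε • ξ
  set g : Vec n → Sym n := A.indicator fun _ => w
  have hg : Integrable g volume := integrable_indicator_const hA hfin w
  set q := (volume : Measure (Vec n)).withDensityᵥ g
  -- For `w = 0` the convention `0⁻¹ = 0` gives `d = 0`, which is still a valid density with respect
  -- to the zero variation.
  set d : Sym n := ‖w‖⁻¹ • w
  have hdw : ‖w‖ • d = w := by
    rcases eq_or_ne w 0 with h | h
    · simp [d, h]
    · rw [smul_smul, mul_inv_cancel₀ (norm_ne_zero_iff.2 h), one_smul]
  have hvar : q.variation = ‖w‖ₑ • volume.restrict A := by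
    refine (Measure.variation_withDensityᵥ hg).trans ?_
    have h : (fun x => ‖g x‖ₑ) = A.indicator fun _ => ‖w‖ₑ := by
      ext x
      by_cases hx : x ∈ A
      · simp [g, hx]
      · simp only [g, indicator_of_notMem hx]
        exact enorm_zero
    rw [h, withDensity_indicator hA, withDensity_const]
  have hqfin : IsFiniteMeasure q.variation := isFiniteMeasure_variation q
  have hq : q = q.variation.withDensityᵥ fun _ => d := by
    ext1 s hs
    rw [withDensityᵥ_apply hg hs, withDensityᵥ_apply (integrable_const d) hs, setIntegral_const,
      setIntegral_indicator hA, setIntegral_const, hvar, measureReal_def, measureReal_def,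
      Measure.smul_apply, Measure.restrict_apply hs, smul_eq_mul, ENNReal.toReal_mul, toReal_enorm,
      mul_comm, mul_smul, hdw]
  have hdens : density q q.variation =ᵐ[q.variation] fun _ => d := by
    have h := density_withDensityᵥ (μ := q.variation) (integrable_const d)
    rwa [← hq] at h
  have hsupp : M.supportFn d ≤ ENNReal.ofReal (‖w‖⁻¹ * (ε * c)) := by
    refine iSup₂_le fun σ hσ => ENNReal.ofReal_le_ofReal ?_
    simp only [d, w, sym_inner_smul_right]
    have := hK σ hσ
    gcongr
  calc M.plastic q = ∫⁻ _, M.supportFn d ∂q.variation := by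
        refine lintegral_congr_ae ?_
        filter_upwards [hdens] with x hx
        rw [hx]
    _ = M.supportFn d * (‖w‖ₑ * volume A) := by
        rw [lintegral_const, hvar]
        simp
    _ ≤ ENNReal.ofReal (‖w‖⁻¹ * (ε * c)) * (‖w‖ₑ * volume A) := by gcongr
    _ ≤ ENNReal.ofReal (ε * c * volume.real A) := by
        rw [← ofReal_norm w, ← ENNReal.ofReal_toReal hfin, ← ENNReal.ofReal_mul (norm_nonneg _),
          ← ENNReal.ofReal_mul (by positivity)]
        refine ENNReal.ofReal_le_ofReal ?_
        change ‖w‖⁻¹ * (ε * c) * (‖w‖ * volume.real A) ≤ ε * c * volume.real A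
        -- An inequality rather than an equality, so that `w = 0` is included.
        have h1 : ‖w‖⁻¹ * ‖w‖ ≤ 1 := inv_mul_le_one
        calc ‖w‖⁻¹ * (ε * c) * (‖w‖ * volume.real A)
            = ‖w‖⁻¹ * ‖w‖ * (ε * c * volume.real A) := by ring
          _ ≤ 1 * (ε * c * volume.real A) := by gcongr
          _ = _ := one_mul _

open Classical in
/-- The bilinear form `ℂ₁(a) ξ : ζ` for `a ∈ [0, 1)`, extended by zero to all `a`. -/
def hardForm (M : Model n) (a : ℝ) (ξ ζ : Sym n) : ℝ :=
  if a ∈ Ico (0 : ℝ) 1 then ⟪M.C1 a ξ, ζ⟫ else 0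

lemma hardForm_add (hM : M.Standing) (a : ℝ) (ξ ζ : Sym n) :
    M.hardForm a (ξ + ζ) (ξ + ζ) = M.hardForm a ξ ξ + 2 * M.hardForm a ξ ζ + M.hardForm a ζ ζ := by
  unfold hardForm
  split_ifs with ha
  · simp only [map_add, inner_add_left, inner_add_right]
    rw [hM.C1_symm a ha ζ ξ, real_inner_comm (M.C1 a ξ) ζ]
    ring
  · simp

lemma hardForm_smul_right (a : ℝ) (ξ ζ : Sym n) (c : ℝ) :
    M.hardForm a ξ (c • ζ) = c * M.hardForm a ξ ζ := by
  unfold hardForm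
  split_ifs with ha
  · rw [sym_inner_smul_right]
  · simp

lemma hardForm_smul_left (a : ℝ) (ξ ζ : Sym n) (c : ℝ) :
    M.hardForm a (c • ξ) ζ = c * M.hardForm a ξ ζ := by
  unfold hardForm
  split_ifs with ha
  · rw [map_smul, sym_inner_smul_left]
  · simp

lemma hardForm_self_nonneg (hM : M.Standing) (a : ℝ) (ξ : Sym n) : 0 ≤ M.hardForm a ξ ξ := by
  unfold hardForm
  split_ifs with ha
  · obtain ⟨γ, -, hγ, h⟩ := hM.C1_coercive
    exact (mul_nonneg (hγ a ⟨ha.1, ha.2.le⟩).1 (sq_nonneg _)).trans (h a ha ξ)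
  · exact le_rfl

/-- `ℂ₁` is continuous only on `[0, 1)`; the extension by zero glues two continuous pieces along a
Borel set. -/
lemma measurable_hardForm (hM : M.Standing) :
    Measurable fun z : ℝ × Sym n × Sym n => M.hardForm z.1 z.2.1 z.2.2 := by
  classical
  have h : (fun z : ℝ × Sym n × Sym n => M.hardForm z.1 z.2.1 z.2.2) =
      (Ico (0 : ℝ) 1 ×ˢ (univ : Set (Sym n × Sym n))).piecewise
        (fun z => ⟪M.C1 z.1 z.2.1, z.2.2⟫) 0 := by
    ext z
    by_cases hz : z.1 ∈ Ico (0 : ℝ) 1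
    · rw [piecewise_eq_of_mem (hi := show z ∈ Ico (0 : ℝ) 1 ×ˢ univ from ⟨hz, mem_univ _⟩), hardForm, if_pos hz]
    · rw [piecewise_eq_of_notMem _ _ _ fun h => hz h.1, hardForm, if_neg hz]
      rfl
  rw [h]
  refine ContinuousOn.measurable_piecewise ?_ continuousOn_const
    (measurableSet_Ico.prod MeasurableSet.univ)
  have h1 : ContinuousOn (fun z : ℝ × Sym n × Sym n => M.C1 z.1) (Ico (0 : ℝ) 1 ×ˢ univ) :=
    hM.C1_cont.comp continuousOn_fst fun z hz => hz.1
  exact (h1.clm_apply (continuous_snd.fst.continuousOn)).inner continuous_snd.snd.continuousOn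

/-- `ℂ₁` blows up at `1`, but it is bounded on the compact interval `[0, R]`. -/
lemma exists_abs_hardForm_le (hM : M.Standing) {R : ℝ} (hR : R < 1) :
    ∃ B, ∀ a ∈ Icc (0 : ℝ) R, ∀ ξ ζ, |M.hardForm a ξ ζ| ≤ B * ‖ξ‖ * ‖ζ‖ := by
  have hsub : Icc (0 : ℝ) R ⊆ Ico 0 1 := fun a ha => ⟨ha.1, ha.2.trans_lt hR⟩
  obtain ⟨B, hB⟩ := isCompact_Icc.exists_bound_of_continuousOn (f := M.C1)
    (hM.C1_cont.mono hsub)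
  refine ⟨B, fun a ha ξ ζ => ?_⟩
  rw [hardForm, if_pos (hsub ha)]
  refine (abs_real_inner_le_norm _ _).trans ?_
  gcongr
  exact (M.C1 a).le_of_opNorm_le (hB a ha) ξ

variable {α : H1 M.Ω M.Ω ℝ}

/-- The conditions under which `Q̃(α, p)` is given by an integral. -/
def HardeningCond (M : Model n) (α : H1 M.Ω M.Ω ℝ) (p : VectorMeasure (Vec n) (Sym n)) : Prop :=
  (∃ a, IsQuasicontRep M.Ω α.toFun a ∧
    (singPart p).variation ({x ∈ M.Ω | 0 < a x} ∪ {x ∈ M.ΓD | 0 < α.trace x}) = 0) ∧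
    ∀ᵐ x ∂(volume.restrict M.Ω), α.toFun x = 1 → acDensity p x = 0

lemma hardening_eq_lintegral (hM : M.Standing)
    (hα : ∀ᵐ x ∂(volume.restrict M.Ω), α.toFun x ∈ Icc (0 : ℝ) 1)
    {p : VectorMeasure (Vec n) (Sym n)} (hp : M.HardeningCond α p) :
    M.hardening α p =
      ∫⁻ x in M.Ω, ENNReal.ofReal (M.hardForm (α.toFun x) (acDensity p x) (acDensity p x)) := by
  -- The set `{α ≠ 1}` need not be measurable, since `α` is only a.e. measurable; a Borel
  -- representative replaces it. On `{α = 1}` the extended form is zero, so the integral may run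
  -- over all of `Ω`.
  have hm := α.memLp.1.aemeasurable
  set a := hm.mk α.toFun
  have ha : α.toFun =ᵐ[volume.restrict M.Ω] a := hm.ae_eq_mk
  have hB : MeasurableSet {x | a x ≠ 1} := hm.measurable_mk (measurableSet_singleton 1).compl
  have hset : ({x ∈ M.Ω | α.toFun x ≠ 1} : Set (Vec n)) =ᵐ[volume]
      (({x | a x ≠ 1} ∩ M.Ω : Set (Vec n))) := by
    filter_upwards [(ae_restrict_iff' hM.isOpen.measurableSet).1 ha] with x hx
    apply propext
    change (x ∈ M.Ω ∧ α.toFun x ≠ 1) ↔ (a x ≠ 1 ∧ x ∈ M.Ω)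
    constructor
    · rintro ⟨h1, h2⟩
      exact ⟨hx h1 ▸ h2, h1⟩
    · rintro ⟨h1, h2⟩
      exact ⟨h2, (hx h2).symm ▸ h1⟩
  unfold HardeningCond at hp
  rw [hardening, if_pos hp, Measure.restrict_congr_set hset, ← Measure.restrict_restrict hB,
    ← lintegral_indicator hB]
  refine lintegral_congr_ae ?_
  filter_upwards [ha, hα] with x hx hx1
  by_cases h : a x = 1
  · rw [indicator_of_notMem (by simp [h]), hx, h, hardForm, if_neg (by simp)]
    simp
  · rw [indicator_of_mem (by exact h), hardForm,
      if_pos ⟨hx1.1, lt_of_le_of_ne hx1.2 (by rw [hx]; exact h)⟩]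

lemma HardeningCond.add_withDensityᵥ {p : VectorMeasure (Vec n) (Sym n)}
    (hp : M.HardeningCond α p) {g : Vec n → Sym n} (hg : Integrable g volume)
    (hg0 : ∀ᵐ x ∂(volume.restrict M.Ω), α.toFun x = 1 → g x = 0) :
    M.HardeningCond α (p + volume.withDensityᵥ g) := by
  obtain ⟨⟨a, h1, h2⟩, h3⟩ := hp
  refine ⟨⟨a, h1, ?_⟩, ?_⟩
  · rwa [singPart_add_withDensityᵥ p hg]
  · filter_upwards [hg0, h3, ae_restrict_of_ae (acDensity_add_withDensityᵥ p hg)]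
      with x hx1 hx2 hx3 h
    rw [hx3, Pi.add_apply, hx1 h, hx2 h, add_zero]

/-- The expansion of the hardening energy along a bounded perturbation of the density of `p`
supported in a set where `α` is bounded away from `1`. -/
lemma hardening_add_indicator (hM : M.Standing)
    (hα : ∀ᵐ x ∂(volume.restrict M.Ω), α.toFun x ∈ Icc (0 : ℝ) 1)
    {p : VectorMeasure (Vec n) (Sym n)} (hp : M.hardening α p ≠ ⊤) {A : Set (Vec n)}
    (hA : MeasurableSet A) (hAΩ : A ⊆ M.Ω) (hfin : volume A ≠ ⊤)
    (hA1 : ∀ᵐ x ∂(volume.restrict M.Ω), x ∈ A → α.toFun x < 1) {ξ : Sym n}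
    (hint1 : IntegrableOn (fun x => M.hardForm (α.toFun x) (acDensity p x) ξ) A)
    (hint2 : IntegrableOn (fun x => M.hardForm (α.toFun x) ξ ξ) A) (ε : ℝ) :
    M.hardening α (p + volume.withDensityᵥ (A.indicator fun _ => ε • ξ)) ≠ ⊤ ∧
    (M.hardening α (p + volume.withDensityᵥ (A.indicator fun _ => ε • ξ))).toReal =
      (M.hardening α p).toReal + ε * (2 * ∫ x in A, M.hardForm (α.toFun x) (acDensity p x) ξ) +
        ε ^ 2 * ∫ x in A, M.hardForm (α.toFun x) ξ ξ := by
  set g : Vec n → Sym n := A.indicator fun _ => ε • ξ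
  have hg : Integrable g volume := integrable_indicator_const hA hfin _
  have hcond : M.HardeningCond α p := by
    by_contra h
    exact hp (if_neg h)
  have hcond' : M.HardeningCond α (p + volume.withDensityᵥ g) := by
    refine hcond.add_withDensityᵥ hg ?_
    filter_upwards [hA1] with x hx h
    exact indicator_of_notMem (fun hxA => (hx hxA).ne h) _
  set q := acDensity p
  set q' := acDensity (p + volume.withDensityᵥ g)
  set Φ : Vec n → ℝ := fun x => M.hardForm (α.toFun x) (q x) (q x)
  set Ψ : Vec n → ℝ := A.indicator fun x =>
    ε * (2 * M.hardForm (α.toFun x) (q x) ξ) + ε ^ 2 * M.hardForm (α.toFun x) ξ ξ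
  have hΨA : IntegrableOn (fun x =>
    ε * (2 * M.hardForm (α.toFun x) (q x) ξ) + ε ^ 2 * M.hardForm (α.toFun x) ξ ξ) A :=
    ((hint1.const_mul 2).const_mul ε).add (hint2.const_mul _)
  have hΨ : Integrable Ψ (volume.restrict M.Ω) :=
    ((integrable_indicator_iff hA).2 hΨA).restrict
  have hΦm : AEStronglyMeasurable Φ (volume.restrict M.Ω) := by
    have hq : AEMeasurable q (volume.restrict M.Ω) := (measurable_density p volume).aemeasurable
    exact ((measurable_hardForm hM).comp_aemeasurable
      (α.memLp.1.aemeasurable.prodMk (hq.prodMk hq))).aestronglyMeasurable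
  have hH := hardening_eq_lintegral hM hα hcond
  have hH' := hardening_eq_lintegral hM hα hcond'
  have hΦ0 : 0 ≤ᵐ[volume.restrict M.Ω] Φ := ae_of_all _ fun x => hardForm_self_nonneg hM _ _
  -- Finiteness of the hardening energy is exactly integrability of this nonnegative integrand,
  -- which permits splitting the integral of the expanded square.
  have hΦ : Integrable Φ (volume.restrict M.Ω) := by
    refine ⟨hΦm, ?_⟩
    rw [hasFiniteIntegral_iff_ofReal hΦ0]
    exact lt_top_iff_ne_top.2 (hH ▸ hp)
  have hsum : (fun x => M.hardForm (α.toFun x) (q' x) (q' x)) =ᵐ[volume.restrict M.Ω] Φ + Ψ := by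
    filter_upwards [ae_restrict_of_ae (acDensity_add_withDensityᵥ p hg)] with x hx
    change M.hardForm _ (acDensity _ x) (acDensity _ x) = Φ x + Ψ x
    rw [hx, Pi.add_apply]
    by_cases hxA : x ∈ A
    · simp only [g, Ψ, Φ, indicator_of_mem hxA]
      rw [hardForm_add hM, hardForm_smul_right, hardForm_smul_right, hardForm_smul_left]
      ring
    · simp only [g, Ψ, Φ, indicator_of_notMem hxA, add_zero]
      rfl
  have hint : Integrable (fun x => M.hardForm (α.toFun x) (q' x) (q' x))
      (volume.restrict M.Ω) := (hΦ.add hΨ).congr hsum.symm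
  have h0' : 0 ≤ᵐ[volume.restrict M.Ω] fun x => M.hardForm (α.toFun x) (q' x) (q' x) :=
    ae_of_all _ fun x => hardForm_self_nonneg hM _ _
  rw [← ofReal_integral_eq_lintegral_ofReal hΦ hΦ0] at hH
  rw [← ofReal_integral_eq_lintegral_ofReal hint h0'] at hH'
  refine ⟨by rw [hH']; exact ENNReal.ofReal_ne_top, ?_⟩
  rw [hH, hH', ENNReal.toReal_ofReal (integral_nonneg_of_ae hΦ0),
    ENNReal.toReal_ofReal (integral_nonneg_of_ae h0'), integral_congr_ae hsum]
  have e1 : ∫ x in M.Ω, (Φ + Ψ) x = (∫ x in M.Ω, Φ x) + ∫ x in M.Ω, Ψ x := integral_add hΦ hΨ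
  have e2 : ∫ x in M.Ω, Ψ x = ε * (2 * ∫ x in A, M.hardForm (α.toFun x) (q x) ξ) +
      ε ^ 2 * ∫ x in A, M.hardForm (α.toFun x) ξ ξ := by
    rw [setIntegral_indicator hA, inter_eq_right.2 hAΩ,
      integral_add ((hint1.const_mul 2).const_mul ε) (hint2.const_mul _), integral_const_mul,
      integral_const_mul, integral_const_mul]
  rw [e1, e2, add_assoc]

end Model

/-! ### The stress constraint -/

/-- A closed convex set of matrices is an intersection of countably many half-spaces. -/
lemma exists_countable_halfSpaces {K : Set (Sym n)} (hK : IsClosed K) (hconv : Convex ℝ K) :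
    ∃ T : Set (Sym n × ℝ), T.Countable ∧ (∀ z ∈ T, ∀ σ ∈ K, ⟪σ, z.1⟫ ≤ z.2) ∧
      ∀ τ, (∀ z ∈ T, ⟪τ, z.1⟫ ≤ z.2) → τ ∈ K := by
  -- The complement of `K` is the union of the open half-spaces opposite to all half-spaces
  -- containing `K`. By the Lindelöf property countably many of them have the same union, and
  -- Hahn–Banach shows that no point outside `K` is missed.
  set I : Set (Sym n × ℝ) := {z | ∀ σ ∈ K, ⟪σ, z.1⟫ ≤ z.2}
  obtain ⟨T, hTI, hT, hU⟩ := TopologicalSpace.isOpen_biUnion_countable I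
    (fun z => {τ : Sym n | z.2 < ⟪τ, z.1⟫}) fun z _ =>
      isOpen_lt continuous_const (continuous_id.inner continuous_const)
  refine ⟨T, hT, fun z hz => hTI hz, fun τ hτ => ?_⟩
  by_contra hτK
  obtain ⟨f, u, hf, hu⟩ := geometric_hahn_banach_closed_point hconv hK hτK
  set ζ : Sym n := (InnerProductSpace.toDual ℝ (Sym n)).symm f
  have hζ : ∀ σ, ⟪σ, ζ⟫ = f σ := fun σ => by
    rw [real_inner_comm]
    exact InnerProductSpace.toDual_symm_apply
  have hmem : τ ∈ ⋃ z ∈ I, {τ : Sym n | z.2 < ⟪τ, z.1⟫} :=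
    mem_biUnion (x := (ζ, u)) (fun σ hσ => by rw [hζ]; exact (hf σ hσ).le)
      (by change u < ⟪τ, ζ⟫; rw [hζ]; exact hu)
  rw [← hU] at hmem
  obtain ⟨z, hz, hlt⟩ := mem_iUnion₂.1 hmem
  exact absurd (hτ z hz) (not_le.2 hlt)

/-! ### Exchange of elastic and plastic strain, and localization. -/

namespace Loading

variable {M : Model n} {L : Loading M} {t : ℝ} {s : State M}

/-- Stability with respect to the exchange of elastic for plastic strain in a set `A` where `α`
is bounded away from `1`. -/
lemma Stable.setIntegral_inner_le (hs : L.Stable t s) (hM : M.Standing)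
    (hα : ∀ᵐ x ∂(volume.restrict M.Ω), s.α.toFun x ∈ Icc (0 : ℝ) 1) {ξ : Sym n} {c : ℝ}
    (hK : ∀ σ ∈ M.K, ⟪σ, ξ⟫ ≤ c) {A : Set (Vec n)} (hA : MeasurableSet A) (hAΩ : A ⊆ M.Ω)
    (hA1 : ∀ᵐ x ∂(volume.restrict M.Ω), x ∈ A → s.α.toFun x < 1)
    (hint1 : IntegrableOn (fun x => M.hardForm (s.α.toFun x) (acDensity s.p x) ξ) A)
    (hint2 : IntegrableOn (fun x => M.hardForm (s.α.toFun x) ξ ξ) A) :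
    (∫ x in A, ⟪M.C (s.e x), ξ⟫) - 2 * (∫ x in A, M.hardForm (s.α.toFun x) (acDensity s.p x) ξ) ≤
      c * volume.real A := by
  have hα0 : ∀ᵐ x ∂(volume.restrict M.Ω), 0 ≤ s.α.toFun x := hα.mono fun x hx => hx.1
  have hfin : volume A ≠ ⊤ := ((measure_mono hAΩ).trans_lt hM.bounded.measure_lt_top).ne
  have hΩfin : IsFiniteMeasure (volume.restrict M.Ω) :=
    ⟨by simpa using hM.bounded.measure_lt_top⟩
  -- Because `0 ∈ K`.
  have hc : 0 ≤ c := by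
    obtain ⟨r, hr, h⟩ := hM.K_ball
    simpa using hK 0 (h (Metric.mem_closedBall_self hr.le))
  set η : Vec n → Sym n := A.indicator fun _ => -ξ
  have hη : MemLp η 2 (volume.restrict M.Ω) := (memLp_const (-ξ)).indicator hA
  have hηi : Integrable η volume := integrable_indicator_const hA hfin _
  have hg : ∀ ε : ℝ, Integrable (A.indicator fun _ => ε • ξ) (volume : Measure (Vec n)) :=
    fun ε => integrable_indicator_const hA hfin _
  have hcancel : ∀ (ε : ℝ) x, ε • η x + A.indicator (fun _ => ε • ξ) x = 0 := fun ε x => by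
    by_cases hx : x ∈ A <;> simp [η, hx]
  have hdisj : ∀ (ε : ℝ) (B : Set (Vec n)), Disjoint B A →
      (volume : Measure (Vec n)).withDensityᵥ (A.indicator fun _ => ε • ξ) B = 0 := by
    intro ε B hBA
    by_cases hB : MeasurableSet B
    · rw [withDensityᵥ_apply (hg ε) hB, setIntegral_indicator hA, disjoint_iff_inter_eq_empty.1 hBA,
        Measure.restrict_empty, integral_zero_measure]
    · exact VectorMeasure.not_measurable _ hB
  -- The two perturbations cancel in `e + p`, so `u` is kept and the loads do no work; since `A ⊆
  -- Ω`, the boundary part of `p` is untouched.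
  have hadm : ∀ ε : ℝ, M.Admissible (L.w t) s.u (fun x => s.e x + ε • η x)
      (s.p + volume.withDensityᵥ (A.indicator fun _ => ε • ξ)) := fun ε =>
    { e_memLp := hs.1.e_memLp.add (hη.const_smul ε)
      p_concentrated := fun B hB => by
        rw [add_apply, hs.1.p_concentrated B hB,
          hdisj ε B (hB.mono_right (hAΩ.trans subset_union_left)), add_zero]
      strain_eq := fun B hB hBΩ => by
        have h1 : IntegrableOn s.e B := (hs.1.e_memLp.integrable one_le_two).mono_measure
          (Measure.restrict_mono hBΩ le_rfl)
        have h2 : IntegrableOn (fun x => ε • η x) B := (hηi.integrableOn).fun_smul ε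
        have h3 : (∫ x in B, ε • η x) + ∫ x in B, A.indicator (fun _ => ε • ξ) x = 0 := by
          rw [← integral_add h2 (hg ε).integrableOn]
          simp only [hcancel, integral_zero]
        rw [add_apply, withDensityᵥ_apply (hg ε) hB, hs.1.strain_eq B hB hBΩ,
          integral_add h1 h2]
        nth_rw 1 [← add_zero ((∫ x in B, s.e x) + s.p B), ← h3]
        abel
      boundary_eq := fun B hB hBD => by
        rw [add_apply, hs.1.boundary_eq B hB hBD,
          hdisj ε B ((Model.disjoint_dirichlet hM).symm.mono hBD hAΩ), add_zero] }
  have hηint : ∫ x in M.Ω, ⟪M.C (s.e x), η x⟫ = -∫ x in A, ⟪M.C (s.e x), ξ⟫ := by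
    have h : (fun x => ⟪M.C (s.e x), η x⟫) = A.indicator fun x => -⟪M.C (s.e x), ξ⟫ := by
      ext x
      by_cases hx : x ∈ A <;> simp [η, hx]
    rw [h, setIntegral_indicator hA, inter_eq_right.2 hAΩ, integral_neg]
  -- Only `ε > 0` is available here: the dissipation is positively homogeneous but not linear, so
  -- the condition is one-sided.
  have key : ∀ ε > 0, ε * ((∫ x in A, ⟪M.C (s.e x), ξ⟫) -
      2 * (∫ x in A, M.hardForm (s.α.toFun x) (acDensity s.p x) ξ) - c * volume.real A) ≤
      ε ^ 2 * (M.elastic η + ∫ x in A, M.hardForm (s.α.toFun x) ξ ξ) := by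
    intro ε hε
    obtain ⟨hne, hval⟩ := Model.hardening_add_indicator hM hα (hs.hardening_ne_top hM hα0) hA hAΩ
      hfin hA1 hint1 hint2 ε
    have h := hs.le_competitor hM hα0 (hadm ε) hne (d := ε * c * volume.real A) (by positivity)
      (by rw [add_sub_cancel_left]; exact Model.plastic_withDensityᵥ_indicator_le hA hfin hc hK hε)
    rw [Model.elastic_add hM hs.1.e_memLp hη, hηint, hval] at h
    linarith
  have := le_zero_of_forall_quadratic key
  linarith

/-- The set where the inequality fails is exhausted by sets `A N` on which `α` stays away from `1`
and `p^a` is bounded, so that all terms are integrable. The integrated inequality on `A N` then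
forces it to be null. -/
lemma Stable.ae_inner_le (hs : L.Stable t s) (hM : M.Standing)
    (hα : ∀ᵐ x ∂(volume.restrict M.Ω), s.α.toFun x ∈ Icc (0 : ℝ) 1) {ξ : Sym n} {c : ℝ}
    (hK : ∀ σ ∈ M.K, ⟪σ, ξ⟫ ≤ c) :
    ∀ᵐ x ∂(volume.restrict M.Ω), s.α.toFun x < 1 →
      ⟪M.C (s.e x) - (2 : ℝ) • M.C1 (s.α.toFun x) (acDensity s.p x), ξ⟫ ≤ c := by
  have hΩfin : IsFiniteMeasure (volume.restrict M.Ω) :=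
    ⟨by simpa using hM.bounded.measure_lt_top⟩
  have hαm := s.α.memLp.1.aemeasurable
  have hem := hs.1.e_memLp.1.aemeasurable
  -- Borel representatives are needed for the sets `A N` to be measurable.
  set a := hαm.mk s.α.toFun
  set e := hem.mk s.e
  have ha : s.α.toFun =ᵐ[volume.restrict M.Ω] a := hαm.ae_eq_mk
  have he : s.e =ᵐ[volume.restrict M.Ω] e := hem.ae_eq_mk
  have ham : Measurable a := hαm.measurable_mk
  set q := acDensity s.p
  have hq : Measurable q := measurable_density s.p volume
  have hC : Continuous fun τ : Sym n => ⟪M.C τ, ξ⟫ :=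
    M.C.continuous.inner continuous_const
  have hσm : Measurable fun x => ⟪M.C (e x), ξ⟫ := hC.measurable.comp hem.measurable_mk
  have hhm : ∀ ζ : Vec n → Sym n, Measurable ζ → Measurable fun x => M.hardForm (a x) (ζ x) ξ :=
    fun ζ hζ => (Model.measurable_hardForm hM).comp (ham.prodMk (hζ.prodMk measurable_const))
  set g : Vec n → ℝ := fun x => ⟪M.C (e x), ξ⟫ - 2 * M.hardForm (a x) (q x) ξ - c
  have hgm : Measurable g := (hσm.sub ((hhm q hq).const_mul 2)).sub_const c
  set R : ℕ → ℝ := fun N => 1 - 1 / ((N : ℝ) + 1)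
  have hR1 : ∀ N, R N < 1 := fun N => by
    have : (0 : ℝ) < 1 / ((N : ℝ) + 1) := by positivity
    simp only [R]; linarith
  set A : ℕ → Set (Vec n) := fun N => M.Ω ∩ ({x | a x ∈ Icc 0 (R N)} ∩ {x | ‖q x‖ ≤ N} ∩
    {x | 0 < g x})
  have hAm : ∀ N, MeasurableSet (A N) := fun N => hM.isOpen.measurableSet.inter
    (((ham measurableSet_Icc).inter (measurableSet_le hq.norm measurable_const)).inter
      (measurableSet_lt measurable_const hgm))
  have hnull : ∀ N, volume (A N) = 0 := by
    intro N
    have hAΩ : A N ⊆ M.Ω := inter_subset_left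
    have hle : volume.restrict (A N) ≤ volume.restrict M.Ω := Measure.restrict_mono hAΩ le_rfl
    have hAfin : IsFiniteMeasure (volume.restrict (A N)) := isFiniteMeasure_of_le _ hle
    have haA : ∀ᵐ x ∂(volume.restrict (A N)), s.α.toFun x = a x :=
      ae_mono hle ha
    have heA : ∀ᵐ x ∂(volume.restrict (A N)), s.e x = e x := ae_mono hle he
    obtain ⟨B, hB⟩ := Model.exists_abs_hardForm_le hM (hR1 N)
    have hbdd : ∀ ζ : Vec n → Sym n, Measurable ζ → (∃ D, ∀ x ∈ A N, ‖ζ x‖ ≤ D) →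
        IntegrableOn (fun x => M.hardForm (a x) (ζ x) ξ) (A N) := by
      rintro ζ hζ ⟨D, hD⟩
      refine Integrable.of_bound (hhm ζ hζ).aestronglyMeasurable (|B| * D * ‖ξ‖)
        ((ae_restrict_iff' (hAm N)).2 (ae_of_all _ fun x hx => ?_))
      refine (hB (a x) hx.2.1.1 (ζ x) ξ).trans ?_
      gcongr
      · exact le_abs_self B
      · exact hD x hx
    have hi1 := hbdd q hq ⟨N, fun x hx => hx.2.1.2⟩
    have hi2 := hbdd (fun _ => ξ) measurable_const ⟨‖ξ‖, fun _ _ => le_rfl⟩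
    have hσi : IntegrableOn (fun x => ⟪M.C (s.e x), ξ⟫) (A N) :=
      (((M.C.comp_memLp' hs.1.e_memLp).integrable one_le_two).inner_const ξ).mono_measure hle
    have hσi' : IntegrableOn (fun x => ⟪M.C (e x), ξ⟫) (A N) :=
      hσi.congr (heA.mono fun x hx => by simp only [hx])
    have h := hs.setIntegral_inner_le hM hα hK (hAm N) hAΩ
      (ha.mono fun x hx hxA => by rw [hx]; exact hxA.2.1.1.2.trans_lt (hR1 N))
      (hi1.congr (haA.mono fun x hx => by simp only [hx]; rfl))
      (hi2.congr (haA.mono fun x hx => by simp only [hx]))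
    have hgi : IntegrableOn g (A N) := (hσi'.sub (hi1.const_mul 2)).sub (integrable_const c)
    have hgle : ∫ x in A N, g x ≤ 0 := by
      have e1 : ∫ x in A N, g x = (∫ x in A N, ⟪M.C (e x), ξ⟫) -
          2 * (∫ x in A N, M.hardForm (a x) (q x) ξ) - c * volume.real (A N) := by
        simp only [g]
        rw [integral_sub (hσi'.fun_sub (hi1.const_mul 2)) (integrable_const c),
          integral_sub hσi' (hi1.const_mul 2), integral_const_mul, setIntegral_const, smul_eq_mul,
          mul_comm c]
      have e2 : ∫ x in A N, ⟪M.C (s.e x), ξ⟫ = ∫ x in A N, ⟪M.C (e x), ξ⟫ :=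
        integral_congr_ae (heA.mono fun x hx => by simp only [hx])
      have e3 : ∫ x in A N, M.hardForm (s.α.toFun x) (acDensity s.p x) ξ =
          ∫ x in A N, M.hardForm (a x) (q x) ξ :=
        integral_congr_ae (haA.mono fun x hx => by simp only [hx]; rfl)
      rw [e2, e3] at h
      rw [e1]
      linarith
    -- On `A N` the function `g` is strictly positive, so positive measure would make its integral
    -- positive.
    by_contra hne
    have hpos : 0 < ∫ x in A N, g x := by
      rw [setIntegral_pos_iff_support_of_nonneg_ae
        ((ae_restrict_iff' (hAm N)).2 (ae_of_all _ fun x hx => hx.2.2.le)) hgi]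
      have hsub : Function.support g ∩ A N = A N :=
        inter_eq_right.2 fun x hx => (show 0 < g x from hx.2.2).ne'
      rw [hsub]
      exact pos_iff_ne_zero.2 hne
    exact absurd hgle (not_le.2 hpos)
  have hall : ∀ᵐ x ∂(volume.restrict M.Ω), ∀ N, x ∉ A N :=
    ae_restrict_of_ae (ae_all_iff.2 fun N => measure_eq_zero_iff_ae_notMem.1 (hnull N))
  filter_upwards [hall, ha, he, hα, ae_restrict_mem hM.isOpen.measurableSet]
    with x hx hxa hxe hxα hxΩ hx1
  have hxI : a x ∈ Ico (0 : ℝ) 1 := by rw [← hxa]; exact ⟨hxα.1, hx1⟩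
  have hgx : g x ≤ 0 := by
    by_contra hpos
    -- `N₁` takes care of the bound on `p^a` and `N₂` of the distance of `α` from `1`; both
    -- conditions persist for larger `N`.
    obtain ⟨N₁, hN₁⟩ := exists_nat_ge ‖q x‖
    obtain ⟨N₂, hN₂⟩ := exists_nat_one_div_lt (sub_pos.2 hxI.2)
    refine hx (max N₁ N₂) ⟨hxΩ, ⟨⟨hxI.1, ?_⟩, ?_⟩, not_le.1 hpos⟩
    · have h1 : 1 / (((max N₁ N₂ : ℕ) : ℝ) + 1) ≤ 1 / ((N₂ : ℝ) + 1) := by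
        gcongr
        exact le_max_right _ _
      simp only [R]
      linarith
    · exact hN₁.trans (by exact_mod_cast le_max_left _ _)
  have hgx' : g x = ⟪M.C (s.e x), ξ⟫ - 2 * ⟪M.C1 (s.α.toFun x) (q x), ξ⟫ - c := by
    simp only [g]
    rw [Model.hardForm, if_pos hxI, hxa, hxe]
  rw [inner_sub_left, sym_inner_smul_left]
  linarith

/-- The stress constraint: `ℂe - 2 ℂ₁(α) p ∈ K` a.e. in `{α < 1}`. -/
theorem Stable.ae_mem (hs : L.Stable t s) (hM : M.Standing)
    (hα : ∀ᵐ x ∂(volume.restrict M.Ω), s.α.toFun x ∈ Icc (0 : ℝ) 1) :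
    ∀ᵐ x ∂(volume.restrict M.Ω), s.α.toFun x < 1 →
      M.C (s.e x) - (2 : ℝ) • M.C1 (s.α.toFun x) (acDensity s.p x) ∈ M.K := by
  obtain ⟨T, hT, hTK, hK⟩ := exists_countable_halfSpaces hM.K_closed hM.K_convex
  have h := (ae_ball_iff hT).2 fun z hz => hs.ae_inner_le hM hα (hTK z hz)
  filter_upwards [h] with x hx hx1
  exact hK _ fun z hz => hx z hz hx1

end Loading

end GeoPlast

end

theorem mainTheorem5 {n : ℕ} (hn : 2 ≤ n)
    (M : GeoPlast.Model n) (hM : M.Standing)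
    (L : GeoPlast.Loading M) (hL : L.Standing)
    (s₀ : GeoPlast.State M) (hs₀ : L.InitialDatum s₀)
    (s : ℝ → GeoPlast.State M) (hs : L.Evolution s₀ s) :
    ∀ t ∈ Set.Icc 0 L.T,
      -- `-div σ(t) = f(t)` in `Ω`
      GeoPlast.HasWeakDiv M.Ω (fun x => M.C ((s t).e x)) (-L.f t) ∧
      -- `[σ(t)ν] = g(t)` on the Neumann part of the boundary
      GeoPlast.HasTraction M.Ω M.ΓD M.ΓN (fun x => M.C ((s t).e x)) (-L.f t) (L.g t) ∧
      -- `σ(t) - 2 ℂ₁(α(t)) p(t) ∈ K` almost everywhere where `ℂ₁(α(t))` is defined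
      ∀ᵐ x ∂(volume.restrict M.Ω), (s t).α.toFun x < 1 →
        M.C ((s t).e x) -
          (2 : ℝ) • M.C1 ((s t).α.toFun x) (GeoPlast.acDensity (s t).p x) ∈ M.K := by
  intro t ht
  have hst := hs.stable t ht
  have hα := hs.range t ht
  have hα0 : ∀ᵐ x ∂(volume.restrict M.Ω), 0 ≤ (s t).α.toFun x := hα.mono fun x hx => hx.1
  exact ⟨hst.hasWeakDiv hn hM (hL.f_memLp t ht) (hL.g_memLp t ht) hα0,
    hst.hasTraction hn hM (hL.f_memLp t ht) (hL.g_memLp t ht) hα0, hst.ae_mem hM hα⟩
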